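/- Let $M$ be a smooth manifold and let $(E\to M,\rho,\langle\cdot,\cdot\rangle,[\cdot,\cdot])$ be a Courant algebroid: $E$ is a smooth real vector bundle with a symmetric nondegenerate bilinear form $\langle\cdot,\cdot\rangle$ on its fibres, an anchor $\rho:E\to TM$ (a vector bundle morphism) and an $\mathbb R$-bilinear bracket on $\Gamma(E)$ with $$[a,[b,c]]=[[a,b],c]+[b,[a,c]],\quad \mathcal L_{\rho a}\langle b,c\rangle=\langle[a,b],c\rangle+\langle b,[a,c]\rangle,\quad 2[a,a]=\rho^*d\langle a,a\rangle,$$ where $E^*\cong E$ through $\langle\cdot,\cdot\rangle$. Let $V_+\subseteq E$ be a generalized metric, that is, a subbundle on which $\langle\cdot,\cdot\rangle$ is nondegenerate, let $V_-:=V_+^\perp$, so that $E=V_+\oplus V_-$, and write $a_\pm$ for the component of $a$ in $V_\pm$. Let $\operatorname{div}:\Gamma(E)\to C^\infty(M)$ be a divergence operator, that is, an $\mathbb R$-linear map with $\operatorname{div}(fa)=f\operatorname{div}a+\mathcal L_{\rho a}f$. A generalized connection is an $\mathbb R$-linear map $D:\Gamma(E)\to\Gamma(E^*\otimes E)$, with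 $D_ba:=(Da)b$, such that $D(fa)=f\,Da+\rho^*df\otimes a$ and $\rho^*d\langle a,b\rangle=\langle Da,b\rangle+\langle a,Db\rangle$. It is metric if $D_a(\Gamma(V_\pm))\subseteq\Gamma(V_\pm)$ for all $a\in\Gamma(E)$, it has divergence $\operatorname{div}$ if $\operatorname{tr}(Da)=\operatorname{div}a$ for all $a$, and it has pure-type torsion if its torsion $T(a,b)=D_ab-D_ba-[a,b]+(Da)^*b$, regarded as a section of $\wedge^3E^*$, lies in $\Gamma(\wedge^3V_+\oplus\wedge^3V_-)$. Suppose that neither $V_+$ nor $V_-$ has rank $1$ (at any point of $M$). Then there is a metric connection with divergence $\operatorname{div}$ and pure-type torsion, and for every such connection $D$ the García-Fernández Ricci tensors $$\mathrm{Ric}^\pm_{\mathrm{GF}}(a_\mp,b_\pm):=\operatorname{tr}_\pm\bigl(c_\pm\mapsto D_{c_\pm}D_{a_\mp}b_\pm-D_{a_\mp}D_{c_\pm}b_\pm-D_{[c_\pm,a_\mp]}b_\pm\bigr),$$ where $\operatorname{tr}_\pm$ is the trace on $V_\pm$, are equal to the Ševera–Valach Ricci tensors: for both choices of sign and all $a_\mp\in\Gamma(V_\mp)$,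 $b_\pm\in\Gamma(V_\pm)$, $$\mathrm{Ric}^\pm_{\mathrm{GF}}(a_\mp,b_\pm)=\operatorname{div}([a_\mp,b_\pm]_\pm)-\mathcal L_{\rho a_\mp}(\operatorname{div}b_\pm)-\operatorname{tr}_\pm\,[[\,\cdot\,,a_\mp]_\mp,b_\pm]_\pm .$$ -/

import Mathlib

open Bundle Topology
open scoped Manifold ContDiff Matrix

set_option linter.unusedSectionVars false

noncomputable section

namespace CourantRicci

section Sections

variable {B : Type*} [NormedAddCommGroup B] [NormedSpace ℝ B]
  {M : Type*} [TopologicalSpace M] [ChartedSpace B M]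
  {F : Type*} [NormedAddCommGroup F] [NormedSpace ℝ F]
  {E : M → Type*} [∀ x, AddCommGroup (E x)] [∀ x, Module ℝ (E x)]
  [∀ x, TopologicalSpace (E x)] [TopologicalSpace (TotalSpace F E)]
  [FiberBundle F E] [VectorBundle ℝ F E]

/-! ### Sections as a module over the smooth functions -/

/-- Multiplication of a smooth section by a smooth function. -/
instance instSMulSection : SMul C^∞⟮𝓘(ℝ, B), M; ℝ⟯ Cₛ^∞⟮𝓘(ℝ, B); F, E⟯ :=
  ⟨fun f s => ⟨fun x => f x • s x, f.contMDiff.smul_section s.contMDiff⟩⟩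

@[simp]
theorem smul_section_apply (f : C^∞⟮𝓘(ℝ, B), M; ℝ⟯) (s : Cₛ^∞⟮𝓘(ℝ, B); F, E⟯) (x : M) :
    (f • s) x = f x • s x := rfl

/-- `Γ(E)` is a module over `C^∞(M)`. -/
instance instModuleSection : Module C^∞⟮𝓘(ℝ, B), M; ℝ⟯ Cₛ^∞⟮𝓘(ℝ, B); F, E⟯ where
  one_smul s := by ext x; simp
  mul_smul f g s := by ext x; simp [mul_smul]
  smul_zero f := by ext x; simp
  smul_add f s t := by ext x; simp
  add_smul f g s := by ext x; simp [add_smul]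
  zero_smul s := by ext x; simp

theorem sum_section_apply {ι : Type*} [Fintype ι] (c : ι → Cₛ^∞⟮𝓘(ℝ, B); F, E⟯) (x : M) :
    (∑ i, c i) x = ∑ i, c i x := by
  have h : ⇑(∑ i, c i) = ∑ i, ⇑(c i) :=
    map_sum (ContMDiffSection.coeAddHom 𝓘(ℝ, B) F ∞ E) c Finset.univ
  rw [h, Finset.sum_apply]

/-- The derivative `df (v) = 𝓛_v f` of a smooth function along a tangent vector `v` at `x`. -/
def dirDeriv (f : C^∞⟮𝓘(ℝ, B), M; ℝ⟯) (x : M) (v : TangentSpace 𝓘(ℝ, B) x) : ℝ :=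
  mfderiv 𝓘(ℝ, B) 𝓘(ℝ, ℝ) f x v

theorem dirDeriv_mul (f g : C^∞⟮𝓘(ℝ, B), M; ℝ⟯) (x : M) (v : TangentSpace 𝓘(ℝ, B) x) :
    dirDeriv (f * g) x v = f x * dirDeriv g x v + g x * dirDeriv f x v := by
  have hf := (f.contMDiff.mdifferentiable (by simp) x).hasMFDerivAt
  have hg := (g.contMDiff.mdifferentiable (by simp) x).hasMFDerivAt
  have h := (hf.mul hg).mfderiv
  exact congrArg (fun L => L v) h

theorem dirDeriv_add (f g : C^∞⟮𝓘(ℝ, B), M; ℝ⟯) (x : M) (v : TangentSpace 𝓘(ℝ, B) x) :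
    dirDeriv (f + g) x v = dirDeriv f x v + dirDeriv g x v := by
  have hf := (f.contMDiff.mdifferentiable (by simp) x).hasMFDerivAt
  have hg := (g.contMDiff.mdifferentiable (by simp) x).hasMFDerivAt
  have h := (hf.add hg).mfderiv
  exact congrArg (fun L => L v) h

section Extension

variable [FiniteDimensional ℝ B] [T2Space M] [IsManifold 𝓘(ℝ, B) ∞ M]

/-- A smooth function on an open set agrees near each point with a global smooth function. -/
theorem exists_function_eventuallyEq {u : Set M} (hu : IsOpen u) {x₀ : M} (hx : x₀ ∈ u)
    {f : M → ℝ} (hf : ContMDiffOn 𝓘(ℝ, B) 𝓘(ℝ, ℝ) ∞ f u) :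
    ∃ g : C^∞⟮𝓘(ℝ, B), M; ℝ⟯, ∀ᶠ x in 𝓝 x₀, g x = f x := by
  obtain ⟨ψ, -, hψ⟩ :=
    (SmoothBumpFunction.nhds_basis_tsupport (I := 𝓘(ℝ, B)) x₀).mem_iff.1 (hu.mem_nhds hx)
  have h : ContMDiff 𝓘(ℝ, B) 𝓘(ℝ, ℝ) ∞ fun x => ψ x * f x := by
    refine contMDiff_of_tsupport fun x hxs => ?_
    have hxu : x ∈ u := hψ (tsupport_mul_subset_left hxs)
    exact ψ.contMDiffAt.mul (hf.contMDiffAt (hu.mem_nhds hxu))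
  refine ⟨⟨_, h⟩, ?_⟩
  filter_upwards [ψ.eventuallyEq_one] with x hx1
  change ψ x * f x = f x
  rw [hx1]; simp

/-- A smooth section over an open set agrees near each point with a global smooth section. -/
theorem exists_section_eventuallyEq {u : Set M} (hu : IsOpen u) {x₀ : M} (hx : x₀ ∈ u)
    {s : ∀ x, E x}
    (hs : ContMDiffOn 𝓘(ℝ, B) (𝓘(ℝ, B).prod 𝓘(ℝ, F)) ∞
      (fun x => TotalSpace.mk' F x (s x)) u) :
    ∃ t : Cₛ^∞⟮𝓘(ℝ, B); F, E⟯, ∀ᶠ x in 𝓝 x₀, t x = s x := by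
  obtain ⟨ψ, -, hψ⟩ :=
    (SmoothBumpFunction.nhds_basis_tsupport (I := 𝓘(ℝ, B)) x₀).mem_iff.1 (hu.mem_nhds hx)
  refine ⟨⟨_, ContMDiffOn.smul_section_of_tsupport (ψ := ψ) ψ.contMDiff.contMDiffOn hu hψ hs⟩, ?_⟩
  filter_upwards [ψ.eventuallyEq_one] with x hx1
  change ψ x • s x = s x
  rw [hx1]; simp

variable [FiniteDimensional ℝ F] [ContMDiffVectorBundle ∞ F E 𝓘(ℝ, B)]

/-- Every vector of a fibre is the value of a global smooth section. -/
theorem exists_section_apply_eq {x : M} (v : E x) : ∃ s : Cₛ^∞⟮𝓘(ℝ, B); F, E⟯, s x = v := by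
  obtain ⟨u, hu, h⟩ :=
    FiberBundle.exists_contMDiffOn_extend (k := ∞) 𝓘(ℝ, B) F v
  obtain ⟨w, hwu, hw, hxw⟩ := mem_nhds_iff.1 hu
  obtain ⟨t, ht⟩ := exists_section_eventuallyEq hw hxw (h.mono hwu)
  exact ⟨t, by simpa using ht.self_of_nhds⟩

/-- A `C^∞(M)`-linear endomorphism of `Γ(E)` acts pointwise. -/
theorem tensorial_apply_eq_zero
    (Φ : Cₛ^∞⟮𝓘(ℝ, B); F, E⟯ →ₗ[C^∞⟮𝓘(ℝ, B), M; ℝ⟯] Cₛ^∞⟮𝓘(ℝ, B); F, E⟯)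
    (s : Cₛ^∞⟮𝓘(ℝ, B); F, E⟯) (x : M) (hs : s x = 0) : Φ s x = 0 := by
  have : ContMDiffVectorBundle 1 F E 𝓘(ℝ, B) := ContMDiffVectorBundle.of_le (n := ∞) (by simp)
  let t := trivializationAt F E x
  have hx : x ∈ t.baseSet := FiberBundle.mem_baseSet_trivializationAt F E x
  let b := Module.finBasis ℝ F
  choose e he using fun i => exists_section_eventuallyEq (B := B) t.open_baseSet hx
    (t.contMDiffOn_localFrame_baseSet (I := 𝓘(ℝ, B)) ∞ b i)
  choose f hf using fun i => exists_function_eventuallyEq (B := B) t.open_baseSet hx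
    (contMDiffOn_baseSet_localFrameCoeff (I := 𝓘(ℝ, B)) (e := t) (k := ∞) b
      (s.contMDiff.contMDiffOn) i)
  let r : Cₛ^∞⟮𝓘(ℝ, B); F, E⟯ := s - ∑ i, f i • e i
  have hr : ∀ᶠ y in 𝓝 x, r y = 0 := by
    filter_upwards [Filter.eventually_all.2 he, Filter.eventually_all.2 hf,
      t.eventually_eq_localFrame_sum_coeff_smul (I := 𝓘(ℝ, B)) b hx (s := fun y => s y)]
      with y h1 h2 h3
    have : r y = s y - (∑ i, f i • e i) y := rfl
    rw [this, sum_section_apply, h3, sub_eq_zero]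
    refine Finset.sum_congr rfl fun i _ => ?_
    rw [smul_section_apply, h1, h2]
    rfl
  have hf0 : ∀ i, f i x = 0 := fun i => by
    rw [(hf i).self_of_nhds]
    simp [LinearMap.piApply, hs]
  have hΦr : Φ r x = 0 := by
    obtain ⟨u, hu, huo, hxu⟩ := eventually_nhds_iff.1 hr
    obtain ⟨ψ, -, hψ⟩ :=
      (SmoothBumpFunction.nhds_basis_tsupport (I := 𝓘(ℝ, B)) x).mem_iff.1 (huo.mem_nhds hxu)
    let g : C^∞⟮𝓘(ℝ, B), M; ℝ⟯ := ⟨ψ, ψ.contMDiff⟩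
    have hg : g • r = 0 := by
      ext y
      by_cases hy : y ∈ u
      · simp [hu y hy]
      · have : ψ y = 0 := image_eq_zero_of_notMem_tsupport fun h => hy (hψ h)
        have hgy : g y = 0 := this
        simp [hgy]
    have h1 : (Φ (g • r)) x = g x • Φ r x := by rw [map_smul]; rfl
    have hgx : g x = 1 := ψ.eq_one
    rw [hg, map_zero, hgx, one_smul] at h1
    exact h1.symm
  have hs' : s = r + ∑ i, f i • e i := by simp [r]
  rw [hs', map_add, map_sum]
  change Φ r x + (∑ i, Φ (f i • e i)) x = 0
  rw [hΦr, sum_section_apply, zero_add]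
  refine Finset.sum_eq_zero fun i _ => ?_
  rw [map_smul, smul_section_apply, hf0, zero_smul]

/-- The endomorphism of the fibre `E x` induced by a `C^∞(M)`-linear endomorphism of `Γ(E)`:
a vector is extended to a section, the extension being irrelevant (`fibreMap_apply`). -/
def fibreMap (Φ : Cₛ^∞⟮𝓘(ℝ, B); F, E⟯ →ₗ[C^∞⟮𝓘(ℝ, B), M; ℝ⟯] Cₛ^∞⟮𝓘(ℝ, B); F, E⟯)
    (x : M) : E x →ₗ[ℝ] E x :=
  have key : ∀ s t : Cₛ^∞⟮𝓘(ℝ, B); F, E⟯, s x = t x → Φ s x = Φ t x := fun s t h => by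
    have h1 := tensorial_apply_eq_zero Φ (s - t) x (by simp [h])
    rw [map_sub] at h1
    exact sub_eq_zero.1 h1
  let ext : E x → Cₛ^∞⟮𝓘(ℝ, B); F, E⟯ := fun v => (exists_section_apply_eq v).choose
  have hext : ∀ v, ext v x = v := fun v => (exists_section_apply_eq v).choose_spec
  { toFun := fun v => Φ (ext v) x
    map_add' := fun v w => by
      rw [key (ext (v + w)) (ext v + ext w) (by simp [hext]), map_add]; rfl
    map_smul' := fun c v => by
      let k : C^∞⟮𝓘(ℝ, B), M; ℝ⟯ := ContMDiffMap.const c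
      have h : ext (c • v) x = (k • ext v) x := by
        rw [hext, smul_section_apply, hext]; rfl
      rw [key _ _ h, map_smul]; rfl }

theorem fibreMap_apply
    (Φ : Cₛ^∞⟮𝓘(ℝ, B); F, E⟯ →ₗ[C^∞⟮𝓘(ℝ, B), M; ℝ⟯] Cₛ^∞⟮𝓘(ℝ, B); F, E⟯)
    (s : Cₛ^∞⟮𝓘(ℝ, B); F, E⟯) (x : M) : fibreMap Φ x (s x) = Φ s x := by
  have h := tensorial_apply_eq_zero Φ ((exists_section_apply_eq (B := B) (F := F) (s x)).choose - s)
    x (by simp [(exists_section_apply_eq (B := B) (F := F) (s x)).choose_spec])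
  rw [map_sub] at h
  exact sub_eq_zero.1 h

end Extension
/-- A smooth subbundle of `E`: a family of subspaces which is locally spanned by a smooth frame. -/
def IsSmoothSubbundle (B F : Type*) [NormedAddCommGroup B] [NormedSpace ℝ B]
    [ChartedSpace B M] [NormedAddCommGroup F] [NormedSpace ℝ F]
    [TopologicalSpace (TotalSpace F E)] [FiberBundle F E]
    (V : ∀ x, Submodule ℝ (E x)) : Prop :=
  ∀ x₀ : M, ∃ (k : ℕ) (s : Fin k → ∀ x, E x) (u : Set M), IsOpen u ∧ x₀ ∈ u ∧
    (∀ i, ContMDiffOn 𝓘(ℝ, B) (𝓘(ℝ, B).prod 𝓘(ℝ, F)) ∞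
      (fun x => TotalSpace.mk' F x (s i x)) u) ∧
    ∀ x ∈ u, LinearIndependent ℝ (fun i => s i x) ∧
      Submodule.span ℝ (Set.range fun i => s i x) = V x

end Sections

/-! ### Courant algebroids and generalized connections -/

section Courant

variable (B : Type*) [NormedAddCommGroup B] [NormedSpace ℝ B]
  {M : Type*} [TopologicalSpace M] [ChartedSpace B M] [IsManifold 𝓘(ℝ, B) ∞ M]
  (F : Type*) [NormedAddCommGroup F] [NormedSpace ℝ F]
  (E : M → Type*) [∀ x, AddCommGroup (E x)] [∀ x, Module ℝ (E x)]
  [∀ x, TopologicalSpace (E x)] [TopologicalSpace (TotalSpace F E)]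
  [FiberBundle F E] [VectorBundle ℝ F E]

/-- A Courant algebroid structure on the smooth vector bundle `E → M`. The pairing and the anchor
are given on fibres, and their smoothness says that they take smooth sections to smooth functions
and smooth vector fields. -/
structure CourantAlgebroid where
  /-- the symmetric nondegenerate pairing `⟨·, ·⟩` -/
  pairing : ∀ x, LinearMap.BilinForm ℝ (E x)
  pairing_symm : ∀ x (v w : E x), pairing x v w = pairing x w v
  pairing_nondegenerate : ∀ x, (pairing x).Nondegenerate
  pairing_smooth : ∀ a b : Cₛ^∞⟮𝓘(ℝ, B); F, E⟯,
    ContMDiff 𝓘(ℝ, B) 𝓘(ℝ, ℝ) ∞ fun x => pairing x (a x) (b x)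
  /-- the anchor `ρ : E → TM` -/
  anchor : ∀ x, E x →ₗ[ℝ] TangentSpace 𝓘(ℝ, B) x
  anchor_smooth : ∀ a : Cₛ^∞⟮𝓘(ℝ, B); F, E⟯,
    ContMDiff 𝓘(ℝ, B) 𝓘(ℝ, B).tangent ∞ fun x =>
      (⟨x, anchor x (a x)⟩ : TangentBundle 𝓘(ℝ, B) M)
  /-- the bracket `[·, ·]` on `Γ(E)` -/
  bracket : Cₛ^∞⟮𝓘(ℝ, B); F, E⟯ →ₗ[ℝ] Cₛ^∞⟮𝓘(ℝ, B); F, E⟯ →ₗ[ℝ] Cₛ^∞⟮𝓘(ℝ, B); F, E⟯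
  /-- `[a, [b, c]] = [[a, b], c] + [b, [a, c]]` -/
  jacobi : ∀ a b c, bracket a (bracket b c) = bracket (bracket a b) c + bracket b (bracket a c)
  /-- `𝓛_{ρ a} ⟨b, c⟩ = ⟨[a, b], c⟩ + ⟨b, [a, c]⟩` -/
  invariant : ∀ (a b c : Cₛ^∞⟮𝓘(ℝ, B); F, E⟯) (x : M),
    dirDeriv ⟨fun y => pairing y (b y) (c y), pairing_smooth b c⟩ x (anchor x (a x)) =
      pairing x (bracket a b x) (c x) + pairing x (b x) (bracket a c x)
  /-- `2 [a, a] = ρ^* d ⟨a, a⟩`, where `E^* ≅ E` through the pairing -/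
  two_bracket_self : ∀ (a : Cₛ^∞⟮𝓘(ℝ, B); F, E⟯) (x : M) (v : E x),
    pairing x ((2 : ℝ) • bracket a a x) v =
      dirDeriv ⟨fun y => pairing y (a y) (a y), pairing_smooth a a⟩ x (anchor x v)

variable {B F E}

namespace CourantAlgebroid

variable (C : CourantAlgebroid B F E)

/-- The function `⟨a, b⟩` for sections `a`, `b`. -/
def inner (a b : Cₛ^∞⟮𝓘(ℝ, B); F, E⟯) : C^∞⟮𝓘(ℝ, B), M; ℝ⟯ :=
  ⟨fun x => C.pairing x (a x) (b x), C.pairing_smooth a b⟩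

variable [FiniteDimensional ℝ B] [T2Space M] [FiniteDimensional ℝ F]
  [ContMDiffVectorBundle ∞ F E 𝓘(ℝ, B)]

theorem bracket_smul (f : C^∞⟮𝓘(ℝ, B), M; ℝ⟯) (a b : Cₛ^∞⟮𝓘(ℝ, B); F, E⟯) (x : M) :
    C.bracket a (f • b) x =
      f x • C.bracket a b x + dirDeriv f x (C.anchor x (a x)) • b x := by
  have key : ∀ v : E x, C.pairing x (C.bracket a (f • b) x -
      (f x • C.bracket a b x + dirDeriv f x (C.anchor x (a x)) • b x)) v = 0 := fun v => by
    obtain ⟨c, rfl⟩ := exists_section_apply_eq (B := B) (F := F) v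
    have h1 : dirDeriv (C.inner (f • b) c) x (C.anchor x (a x)) = _ := C.invariant a (f • b) c x
    have h2 : dirDeriv (C.inner b c) x (C.anchor x (a x)) = _ := C.invariant a b c x
    have h3 : C.inner (f • b) c = f * C.inner b c := by
      ext y
      change C.pairing y (f y • b y) (c y) = f y * C.pairing y (b y) (c y)
      rw [map_smul]; rfl
    have h4 : C.inner b c x = C.pairing x (b x) (c x) := rfl
    rw [h3, dirDeriv_mul, h2, h4] at h1
    simp only [smul_section_apply, map_smul, map_sub, map_add, LinearMap.smul_apply,
      LinearMap.sub_apply, LinearMap.add_apply, smul_eq_mul] at h1 ⊢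
    linarith
  exact sub_eq_zero.1 ((C.pairing_nondegenerate x).1 _ key)

theorem bracket_swap {a b : Cₛ^∞⟮𝓘(ℝ, B); F, E⟯} (h : ∀ x, C.pairing x (a x) (b x) = 0) :
    C.bracket a b = - C.bracket b a := by
  ext x
  have key : ∀ v : E x, C.pairing x (C.bracket a b x + C.bracket b a x) v = 0 := fun v => by
    have h1 : _ = dirDeriv (C.inner (a + b) (a + b)) x (C.anchor x v) :=
      C.two_bracket_self (a + b) x v
    have h2 : _ = dirDeriv (C.inner a a) x (C.anchor x v) := C.two_bracket_self a x v
    have h3 : _ = dirDeriv (C.inner b b) x (C.anchor x v) := C.two_bracket_self b x v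
    have h4 : C.inner (a + b) (a + b) = C.inner a a + C.inner b b := by
      ext y
      change C.pairing y (a y + b y) (a y + b y) =
        C.pairing y (a y) (a y) + C.pairing y (b y) (b y)
      have := C.pairing_symm y (b y) (a y)
      simp [h y, this]
    rw [h4, dirDeriv_add, ← h2, ← h3] at h1
    simp only [map_add, map_smul, ContMDiffSection.coe_add, Pi.add_apply, LinearMap.add_apply,
      LinearMap.smul_apply, smul_eq_mul] at h1 ⊢
    linarith
  exact eq_neg_of_add_eq_zero_left ((C.pairing_nondegenerate x).1 _ key)

theorem smul_bracket (f : C^∞⟮𝓘(ℝ, B), M; ℝ⟯) {a b : Cₛ^∞⟮𝓘(ℝ, B); F, E⟯}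
    (h : ∀ x, C.pairing x (a x) (b x) = 0) (x : M) :
    C.bracket (f • a) b x =
      f x • C.bracket a b x - dirDeriv f x (C.anchor x (b x)) • a x := by
  rw [C.bracket_swap (a := f • a) (b := b) (by intro y; simp [h y]), C.bracket_swap h]
  simp only [ContMDiffSection.coe_neg, Pi.neg_apply]
  rw [C.bracket_smul]
  module

end CourantAlgebroid

/-- A divergence operator on a Courant algebroid: `div (f a) = f div a + 𝓛_{ρ a} f`. -/
structure DivergenceOperator (C : CourantAlgebroid B F E) where
  /-- the operator `div : Γ(E) → C^∞(M)` -/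
  toFun : Cₛ^∞⟮𝓘(ℝ, B); F, E⟯ →ₗ[ℝ] C^∞⟮𝓘(ℝ, B), M; ℝ⟯
  leibniz : ∀ (f : C^∞⟮𝓘(ℝ, B), M; ℝ⟯) (a : Cₛ^∞⟮𝓘(ℝ, B); F, E⟯) (x : M),
    toFun (f • a) x = f x * toFun a x + dirDeriv f x (C.anchor x (a x))

/-- A generalized connection `D : Γ(E) → Γ(E^* ⊗ E)`. For a section `a`, `D a` is a smooth
endomorphism of `E`, and `D_b a = (D a) b`. -/
structure GeneralizedConnection (C : CourantAlgebroid B F E) where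
  /-- the operator `a ↦ D a` -/
  toFun : Cₛ^∞⟮𝓘(ℝ, B); F, E⟯ →ₗ[ℝ] ∀ x, (E x →ₗ[ℝ] E x)
  smooth : ∀ a b : Cₛ^∞⟮𝓘(ℝ, B); F, E⟯,
    ContMDiff 𝓘(ℝ, B) (𝓘(ℝ, B).prod 𝓘(ℝ, F)) ∞
      fun x => TotalSpace.mk' F x (toFun a x (b x))
  /-- `D (f a) = f D a + ρ^* df ⊗ a` -/
  leibniz : ∀ (f : C^∞⟮𝓘(ℝ, B), M; ℝ⟯) (a : Cₛ^∞⟮𝓘(ℝ, B); F, E⟯) (x : M) (v : E x),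
    toFun (f • a) x v = f x • toFun a x v + dirDeriv f x (C.anchor x v) • a x
  /-- `ρ^* d ⟨a, b⟩ = ⟨D a, b⟩ + ⟨a, D b⟩` -/
  compatible : ∀ (a b : Cₛ^∞⟮𝓘(ℝ, B); F, E⟯) (x : M) (v : E x),
    dirDeriv (C.inner a b) x (C.anchor x v) =
      C.pairing x (toFun a x v) (b x) + C.pairing x (a x) (toFun b x v)

namespace GeneralizedConnection

variable {C : CourantAlgebroid B F E} (D : GeneralizedConnection C)

/-- The section `D_b a = (D a) b`, written `D.cov b a`. -/
def cov (b a : Cₛ^∞⟮𝓘(ℝ, B); F, E⟯) : Cₛ^∞⟮𝓘(ℝ, B); F, E⟯ :=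
  ⟨fun x => D.toFun a x (b x), D.smooth a b⟩

/-- The divergence `tr (D a)` of a section `a` with respect to `D`. -/
def divergence (a : Cₛ^∞⟮𝓘(ℝ, B); F, E⟯) (x : M) : ℝ :=
  LinearMap.trace ℝ (E x) (D.toFun a x)

/-- The torsion `T (a, b, c) = ⟨D_a b - D_b a - [a, b] + (D a)^* b, c⟩`, where `(D a)^*` is the
adjoint of `D a`, so that `⟨(D a)^* b, c⟩ = ⟨b, D_c a⟩`. -/
def torsion (a b c : Cₛ^∞⟮𝓘(ℝ, B); F, E⟯) (x : M) : ℝ :=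
  C.pairing x ((D.cov a b - D.cov b a - C.bracket a b) x) (c x) +
    C.pairing x (b x) (D.cov c a x)

/-- The naive curvature `𝓡₀ (a, b) c = D_a D_b c - D_b D_a c - D_{[a, b]} c`. -/
def naiveCurvature (a b c : Cₛ^∞⟮𝓘(ℝ, B); F, E⟯) : Cₛ^∞⟮𝓘(ℝ, B); F, E⟯ :=
  D.cov a (D.cov b c) - D.cov b (D.cov a c) - D.cov (C.bracket a b) c

variable [FiniteDimensional ℝ B] [T2Space M] [FiniteDimensional ℝ F]
  [ContMDiffVectorBundle ∞ F E 𝓘(ℝ, B)]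

theorem naiveCurvature_add (a a' b c : Cₛ^∞⟮𝓘(ℝ, B); F, E⟯) :
    D.naiveCurvature (a + a') b c = D.naiveCurvature a b c + D.naiveCurvature a' b c := by
  ext x
  have h : D.cov (a + a') c = D.cov a c + D.cov a' c := by
    ext y; simp [cov]
  simp only [naiveCurvature, h]
  simp [cov]
  abel

/-- The naive curvature is tensorial in the first argument along orthogonal arguments. -/
theorem naiveCurvature_smul (f : C^∞⟮𝓘(ℝ, B), M; ℝ⟯) {a b : Cₛ^∞⟮𝓘(ℝ, B); F, E⟯}
    (h : ∀ x, C.pairing x (a x) (b x) = 0) (c : Cₛ^∞⟮𝓘(ℝ, B); F, E⟯) :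
    D.naiveCurvature (f • a) b c = f • D.naiveCurvature a b c := by
  ext x
  have h1 : D.cov (f • a) c = f • D.cov a c := by
    ext y; simp [cov]
  simp only [naiveCurvature, h1]
  simp only [cov, ContMDiffSection.coe_sub, Pi.sub_apply, ContMDiffSection.coeFn_mk,
    smul_section_apply, map_smul, map_sub, D.leibniz, C.smul_bracket f h]
  module

end GeneralizedConnection

/-! ### Generalized metrics -/

/-- The two signs `±`. -/
inductive Sgn
  | pos
  | neg

/-- The sign `∓` opposite to `±`. -/
def Sgn.opp : Sgn → Sgn
  | .pos => .neg
  | .neg => .pos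

/-- A generalized metric: a subbundle `V₊ ⊆ E` on which the pairing is nondegenerate. -/
structure GeneralizedMetric (C : CourantAlgebroid B F E) where
  /-- the fibres of `V₊` -/
  plus : ∀ x, Submodule ℝ (E x)
  isSmoothSubbundle : IsSmoothSubbundle B F plus
  nondegenerate : ∀ x, ((C.pairing x).restrict (plus x)).Nondegenerate

namespace GeneralizedMetric

variable {C : CourantAlgebroid B F E} (G : GeneralizedMetric C)

/-- The fibres of `V₊` and of `V₋ = V₊^⊥`. -/
def part : Sgn → ∀ x, Submodule ℝ (E x)
  | .pos => G.plus
  | .neg => fun x => (C.pairing x).orthogonal (G.plus x)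

/-- `Γ(V_±)`, the smooth sections of `E` with values in `V_±`. -/
def sections (σ : Sgn) : Submodule C^∞⟮𝓘(ℝ, B), M; ℝ⟯ Cₛ^∞⟮𝓘(ℝ, B); F, E⟯ where
  carrier := {a | ∀ x, a x ∈ G.part σ x}
  add_mem' ha hb x := (G.part σ x).add_mem (ha x) (hb x)
  zero_mem' x := (G.part σ x).zero_mem
  smul_mem' f _ ha x := (G.part σ x).smul_mem (f x) (ha x)

theorem pairing_eq_zero (σ : Sgn) {x : M} {v w : E x} (hv : v ∈ G.part σ x)
    (hw : w ∈ G.part σ.opp x) : C.pairing x v w = 0 := by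
  cases σ with
  | pos => exact hw v hv
  | neg => rw [C.pairing_symm]; exact hv w hw

section

variable [FiniteDimensional ℝ F]

theorem isCompl (σ : Sgn) (x : M) : IsCompl (G.part σ x) (G.part σ.opp x) := by
  have : FiniteDimensional ℝ (E x) := VectorBundle.finiteDimensional ℝ F E x
  have hrefl : (C.pairing x).IsRefl := fun v w h => by rw [C.pairing_symm, h]
  have h := LinearMap.BilinForm.isCompl_orthogonal_of_restrict_nondegenerate hrefl
    (G.nondegenerate x)
  cases σ with
  | pos => exact h
  | neg => exact h.symm

/-- The projection of the fibre `E x` onto `V_±` along `V_∓`. -/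
def fibreProj (σ : Sgn) (x : M) : E x →ₗ[ℝ] E x :=
  (G.part σ x).projection (G.part σ.opp x) (G.isCompl σ x)

theorem fibreProj_mem (σ : Sgn) (x : M) (v : E x) : G.fibreProj σ x v ∈ G.part σ x :=
  Submodule.projection_apply_mem _ v

theorem fibreProj_of_mem {σ : Sgn} {x : M} {v : E x} (hv : v ∈ G.part σ x) :
    G.fibreProj σ x v = v :=
  Submodule.projection_apply_of_mem_left _ hv

theorem fibreProj_of_mem_opp {σ : Sgn} {x : M} {v : E x} (hv : v ∈ G.part σ.opp x) :
    G.fibreProj σ x v = 0 :=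
  (Submodule.projection_apply_eq_zero_iff _).2 hv

theorem fibreProj_pos_add_neg (x : M) (v : E x) :
    G.fibreProj .pos x v + G.fibreProj .neg x v = v :=
  Submodule.projection_add_projection_eq_self (G.isCompl .pos x) v

theorem fibreProj_pos_eq {x : M} {v w : E x} (hw : w ∈ G.plus x)
    (h : ∀ u ∈ G.plus x, C.pairing x u (v - w) = 0) : G.fibreProj .pos x v = w := by
  have h1 : v - w ∈ G.part Sgn.pos.opp x := h
  have h2 : G.fibreProj .pos x v = G.fibreProj .pos x (v - w) + G.fibreProj .pos x w := by
    rw [← map_add, sub_add_cancel]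
  rw [h2, G.fibreProj_of_mem_opp h1, G.fibreProj_of_mem (σ := .pos) hw, zero_add]

theorem contMDiffAt_det {n : Type*} [Fintype n] [DecidableEq n] {x₀ : M}
    {A : M → Matrix n n ℝ} (hA : ∀ i j, ContMDiffAt 𝓘(ℝ, B) 𝓘(ℝ, ℝ) ∞ (fun x => A x i j) x₀) :
    ContMDiffAt 𝓘(ℝ, B) 𝓘(ℝ, ℝ) ∞ (fun x => (A x).det) x₀ := by
  simp only [Matrix.det_apply']
  refine contMDiffAt_finset_sum fun p _ => contMDiffAt_const.mul ?_
  exact contMDiffAt_finset_prod fun i _ => hA _ _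

section Projection

variable [FiniteDimensional ℝ B] [T2Space M] [ContMDiffVectorBundle ∞ F E 𝓘(ℝ, B)]

theorem fibreProj_pos_smooth (a : Cₛ^∞⟮𝓘(ℝ, B); F, E⟯) :
    ContMDiff 𝓘(ℝ, B) (𝓘(ℝ, B).prod 𝓘(ℝ, F)) ∞
      fun x => TotalSpace.mk' F x (G.fibreProj .pos x (a x)) := by
  intro x₀
  obtain ⟨k, s', u, hu, hx₀, hs', hspan⟩ := G.isSmoothSubbundle x₀
  choose s hs using fun i => exists_section_eventuallyEq (B := B) hu hx₀ (hs' i)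
  have hframe : ∀ᶠ x in 𝓝 x₀, LinearIndependent ℝ (fun i => s i x) ∧
      Submodule.span ℝ (Set.range fun i => s i x) = G.plus x := by
    filter_upwards [hu.mem_nhds hx₀, Filter.eventually_all.2 hs] with x hx h
    simpa only [h] using hspan x hx
  let A : M → Matrix (Fin k) (Fin k) ℝ := fun x => .of fun i j => C.pairing x (s i x) (s j x)
  let b : M → Fin k → ℝ := fun x i => C.pairing x (s i x) (a x)
  let c : Fin k → M → ℝ := fun i x => ((A x).det)⁻¹ * ((A x).updateCol i (b x)).det
  have hA : ∀ x, LinearIndependent ℝ (fun i => s i x) ∧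
      Submodule.span ℝ (Set.range fun i => s i x) = G.plus x → (A x).det ≠ 0 := by
    rintro x ⟨hli, hsp⟩ hdet
    obtain ⟨v, hv0, hv⟩ := Matrix.exists_mulVec_eq_zero_iff.2 hdet
    let w : E x := ∑ j, v j • s j x
    have hmem : ∀ j, s j x ∈ G.plus x := fun j => by
      rw [← hsp]; exact Submodule.subset_span ⟨j, rfl⟩
    have hw : w ∈ G.plus x := Submodule.sum_mem _ fun j _ => Submodule.smul_mem _ _ (hmem j)
    have hsw : ∀ i, C.pairing x (s i x) w = 0 := fun i => by
      have := congrFun hv i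
      simpa [Matrix.mulVec, dotProduct, A, w, mul_comm] using this
    have hw0 : (⟨w, hw⟩ : G.plus x) = 0 := by
      refine (G.nondegenerate x).2 _ fun ⟨z, hz⟩ => ?_
      change C.pairing x z w = 0
      rw [← hsp] at hz
      induction hz using Submodule.span_induction with
      | mem z hz => obtain ⟨i, rfl⟩ := hz; exact hsw i
      | zero => simp
      | add y z _ _ hy hz => simp [hy, hz]
      | smul r y _ hy => simp [hy]
    exact hv0 (funext (Fintype.linearIndependent_iff.1 hli v (congrArg Subtype.val hw0)))
  have hAs : ∀ i j, ContMDiffAt 𝓘(ℝ, B) 𝓘(ℝ, ℝ) ∞ (fun x => A x i j) x₀ := fun i j =>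
    (C.pairing_smooth (s i) (s j)).contMDiffAt
  have hc : ∀ i, ContMDiffAt 𝓘(ℝ, B) 𝓘(ℝ, ℝ) ∞ (c i) x₀ := fun i => by
    refine ((contMDiffAt_det hAs).inv₀ (hA x₀ hframe.self_of_nhds)).mul (contMDiffAt_det ?_)
    intro p q
    by_cases hq : q = i
    · subst hq
      simpa [Matrix.updateCol_self] using (C.pairing_smooth (s p) a).contMDiffAt
    · simpa [Matrix.updateCol_ne hq] using hAs p q
  have hsm : ContMDiffAt 𝓘(ℝ, B) (𝓘(ℝ, B).prod 𝓘(ℝ, F)) ∞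
      (fun x => TotalSpace.mk' F x (∑ i, c i x • s i x)) x₀ :=
    ContMDiffAt.sum_section fun i _ => (hc i).smul_section (s i).contMDiff.contMDiffAt
  refine hsm.congr_of_eventuallyEq ?_
  filter_upwards [hframe] with x hx
  have hmem : ∀ j, s j x ∈ G.plus x := fun j => by
    rw [← hx.2]; exact Submodule.subset_span ⟨j, rfl⟩
  congr 1
  refine G.fibreProj_pos_eq
    (Submodule.sum_mem _ fun j _ => Submodule.smul_mem _ _ (hmem j)) fun z hz => ?_
  have hcr : A x *ᵥ (fun i => c i x) = b x := by
    have h1 : (fun i => c i x) = ((A x).det)⁻¹ • (A x).cramer (b x) := by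
      ext i; simp [c, Matrix.cramer_apply]
    rw [h1, Matrix.mulVec_smul, Matrix.mulVec_cramer, smul_smul, inv_mul_cancel₀ (hA x hx),
      one_smul]
  rw [← hx.2] at hz
  induction hz using Submodule.span_induction with
  | mem z hz =>
    obtain ⟨i, rfl⟩ := hz
    have := congrFun hcr i
    simp only [Matrix.mulVec, dotProduct, A, b, Matrix.of_apply] at this
    simp only [map_sub, map_sum, map_smul, smul_eq_mul]
    rw [← this, sub_eq_zero]
    exact Finset.sum_congr rfl fun j _ => mul_comm _ _
  | zero => simp
  | add y z _ _ hy hz => rw [map_add, LinearMap.add_apply, hy, hz, add_zero]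
  | smul r y _ hy => rw [map_smul, LinearMap.smul_apply, hy, smul_zero]

theorem fibreProj_smooth (σ : Sgn) (a : Cₛ^∞⟮𝓘(ℝ, B); F, E⟯) :
    ContMDiff 𝓘(ℝ, B) (𝓘(ℝ, B).prod 𝓘(ℝ, F)) ∞
      fun x => TotalSpace.mk' F x (G.fibreProj σ x (a x)) := by
  cases σ with
  | pos => exact G.fibreProj_pos_smooth a
  | neg =>
    have h := a.contMDiff.sub_section (G.fibreProj_pos_smooth a)
    convert h using 3 with x
    exact eq_sub_of_add_eq' (G.fibreProj_pos_add_neg x (a x))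

/-- The projection `a ↦ a_±` of sections of `E` to sections of `V_±`. -/
def proj (σ : Sgn) :
    Cₛ^∞⟮𝓘(ℝ, B); F, E⟯ →ₗ[C^∞⟮𝓘(ℝ, B), M; ℝ⟯] G.sections σ where
  toFun a := ⟨⟨fun x => G.fibreProj σ x (a x), G.fibreProj_smooth σ a⟩,
    fun x => G.fibreProj_mem σ x (a x)⟩
  map_add' a b := by
    ext x
    exact map_add (G.fibreProj σ x) (a x) (b x)
  map_smul' f a := by
    ext x
    exact map_smul (G.fibreProj σ x) (f x) (a x)

/-- The endomorphism of the fibre of `V_±` at `x` induced by a `C^∞(M)`-linear endomorphism of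
`Γ(V_±)`. -/
def fibreEnd (σ : Sgn) (Φ : G.sections σ →ₗ[C^∞⟮𝓘(ℝ, B), M; ℝ⟯] G.sections σ) (x : M) :
    G.part σ x →ₗ[ℝ] G.part σ x :=
  (((G.part σ x).projectionOnto (G.part σ.opp x) (G.isCompl σ x)) ∘ₗ
    fibreMap ((G.sections σ).subtype ∘ₗ Φ ∘ₗ G.proj σ) x) ∘ₗ (G.part σ x).subtype

theorem fibreEnd_apply (σ : Sgn) (Φ : G.sections σ →ₗ[C^∞⟮𝓘(ℝ, B), M; ℝ⟯] G.sections σ) (x : M)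
    (c : G.sections σ) :
    fibreEnd G σ Φ x ⟨c.1 x, c.2 x⟩ = ⟨(Φ c).1 x, (Φ c).2 x⟩ := by
  have h : G.proj σ c.1 = c := by
    ext y
    exact G.fibreProj_of_mem (c.2 y)
  ext
  change G.fibreProj σ x (fibreMap _ x (c.1 x)) = _
  rw [fibreMap_apply]
  change G.fibreProj σ x ((Φ (G.proj σ c.1)).1 x) = _
  rw [h, G.fibreProj_of_mem ((Φ c).2 x)]

/-- The trace `tr_±` of a `C^∞(M)`-linear endomorphism of `Γ(V_±)`, computed on the fibres. -/
def tr (σ : Sgn) (Φ : G.sections σ →ₗ[C^∞⟮𝓘(ℝ, B), M; ℝ⟯] G.sections σ) (x : M) : ℝ :=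
  LinearMap.trace ℝ (G.part σ x) (G.fibreEnd σ Φ x)

/-- The tensor `[[·, a_∓]_∓, b_±]_±` as an endomorphism of `V_±`. -/
def doubleBracket (σ : Sgn) (a : G.sections σ.opp) (b : G.sections σ) :
    G.sections σ →ₗ[C^∞⟮𝓘(ℝ, B), M; ℝ⟯] G.sections σ where
  toFun c := G.proj σ (C.bracket (G.proj σ.opp (C.bracket c.1 a.1)).1 b.1)
  map_add' c c' := by simp
  map_smul' f c := by
    have h1 : G.proj σ.opp (C.bracket (f • c.1) a.1) = f • G.proj σ.opp (C.bracket c.1 a.1) := by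
      ext x
      change G.fibreProj _ x (C.bracket (f • c.1) a.1 x) =
        f x • G.fibreProj _ x (C.bracket c.1 a.1 x)
      rw [C.smul_bracket f fun y => G.pairing_eq_zero σ (c.2 y) (a.2 y), map_sub, map_smul,
        map_smul, G.fibreProj_of_mem_opp (v := c.1 x) (by cases σ <;> exact c.2 x), smul_zero,
        sub_zero]
    ext x
    simp only [SetLike.val_smul, h1, RingHom.id_apply]
    change G.fibreProj _ x (C.bracket (f • (G.proj σ.opp (C.bracket c.1 a.1)).1) b.1 x) =
      f x • G.fibreProj _ x (C.bracket (G.proj σ.opp (C.bracket c.1 a.1)).1 b.1 x)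
    rw [C.smul_bracket f fun y => by
        rw [C.pairing_symm]
        exact G.pairing_eq_zero σ (b.2 y) ((G.proj σ.opp (C.bracket c.1 a.1)).2 y),
      map_sub, map_smul, map_smul,
      G.fibreProj_of_mem_opp ((G.proj σ.opp (C.bracket c.1 a.1)).2 x), smul_zero, sub_zero]

/-- The tensor `Ric_SV^± (a_∓, b_±) =
div ([a_∓, b_±]_±) - 𝓛_{ρ a_∓} (div b_±) - tr_± [[·, a_∓]_∓, b_±]_±`. -/
def ricciSV (div : DivergenceOperator C) (σ : Sgn) (a : G.sections σ.opp) (b : G.sections σ)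
    (x : M) : ℝ :=
  div.toFun (G.proj σ (C.bracket a.1 b.1)).1 x
    - dirDeriv (div.toFun b.1) x (C.anchor x (a.1 x))
    - G.tr σ (G.doubleBracket σ a b) x

end Projection

end
end GeneralizedMetric

/-! ### Metric connections and their Ricci tensor -/

/-- A metric connection: `D_a (Γ(V_±)) ⊆ Γ(V_±)` for all `a ∈ Γ(E)`. -/
structure MetricConnection {C : CourantAlgebroid B F E} (G : GeneralizedMetric C)
    extends GeneralizedConnection C where
  metric : ∀ (σ : Sgn) (a : Cₛ^∞⟮𝓘(ℝ, B); F, E⟯), ∀ b ∈ G.sections σ,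
    toGeneralizedConnection.cov a b ∈ G.sections σ

namespace MetricConnection

variable [FiniteDimensional ℝ B] [T2Space M] [FiniteDimensional ℝ F]
  [ContMDiffVectorBundle ∞ F E 𝓘(ℝ, B)] {C : CourantAlgebroid B F E} {G : GeneralizedMetric C}
  (D : MetricConnection G)

/-- The connection has divergence `div`. -/
def HasDivergence (div : DivergenceOperator C) : Prop :=
  ∀ a x, D.divergence a x = div.toFun a x

/-- The torsion is of pure type, `T ∈ Γ(∧³ V₊ ⊕ ∧³ V₋)`: it is the sum of its restrictions to
`V₊` and to `V₋`. -/
def HasPureTorsion : Prop :=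
  ∀ a b c x, D.torsion a b c x =
    D.torsion (G.proj .pos a).1 (G.proj .pos b).1 (G.proj .pos c).1 x +
      D.torsion (G.proj .neg a).1 (G.proj .neg b).1 (G.proj .neg c).1 x

/-- The tensor `𝓡_GF^± (·, a_∓) b_±` as an endomorphism of `V_±`. -/
def curvatureGF (σ : Sgn) (a : G.sections σ.opp) (b : G.sections σ) :
    G.sections σ →ₗ[C^∞⟮𝓘(ℝ, B), M; ℝ⟯] G.sections σ where
  toFun c := ⟨D.naiveCurvature c.1 a.1 b.1,
    (G.sections σ).sub_mem ((G.sections σ).sub_mem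
      (D.metric σ _ _ (D.metric σ _ _ b.2)) (D.metric σ _ _ (D.metric σ _ _ b.2)))
      (D.metric σ _ _ b.2)⟩
  map_add' c c' := Subtype.ext (D.naiveCurvature_add c.1 c'.1 a.1 b.1)
  map_smul' f c := Subtype.ext
    (D.naiveCurvature_smul f (fun y => G.pairing_eq_zero σ (c.2 y) (a.2 y)) b.1)

/-- The tensor `Ric_GF^± (a_∓, b_±) = tr_± (𝓡_GF^± (·, a_∓) b_±)`. -/
def ricciGF (σ : Sgn) (a : G.sections σ.opp) (b : G.sections σ) (x : M) : ℝ :=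
  G.tr σ (D.curvatureGF σ a b) x

end MetricConnection
end Courant
end CourantRicci
end

noncomputable section

/-! For a metric connection, purity of the torsion says exactly that the mixed derivatives are
brackets: D_{a_∓} b_± = [a_∓, b_±]_±. Indeed, by orthogonality of V_+ and V_-, T(a_∓, b_±, c_±)
reduces to ⟨D_{a_∓} b_± - [a_∓, b_±], c_±⟩; the other mixed components follow from this one by
invariance of the pairing and skew-symmetry of the bracket on orthogonal sections. The two
directions are `cov_eq_of_hasPureTorsion` and `hasPureTorsion_of_cov`.

Equality of the Ricci tensors (`ricciGF_eq_ricciSV`). Split [c_±, a_∓] into its two components. Its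
V_± component is -D_{a_∓} c_±, and the derivative of b_± along its V_∓ component is again a bracket.
Hence the curvature is c ↦ D_c (D_{a_∓} b_±) - (D_{a_∓} (D b_±)) c - [[c, a_∓]_∓, b_±]_±. All three
endomorphisms take values in V_±, so their traces over V_± agree with traces over E. The first has
trace div [a_∓, b_±]_±. Since traces commute with covariant derivatives
(`trace_covariant_derivative`), the second has trace 𝓛_{ρ a_∓} (div b_±). The third trace is already
the one in the Ševera–Valach tensor.

Existence (`exists_hasDivergence_hasPureTorsion`). A partition of unity gives a connection along the
anchor, and averaging it with its dual makes it compatible with the pairing. Replacing its mixed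
derivatives by brackets, and projecting the others, makes it metric with pure torsion. What remains
is the divergence, whose error is C^∞(M)-linear and so equals ⟨χ, ·⟩ for a section χ. The skew
endomorphisms v ↦ ⟨b_±, v_±⟩ χ_± - ⟨χ_±, b_±⟩ v_± do not affect mixed derivatives and have trace (1
- rk V_±) ⟨χ, b_±⟩. As neither rank is 1, suitable multiples of them cancel the error. -/

namespace CourantRicci

/-! ### Locality of derivatives, functionals and connections -/

section Locality

variable {B : Type*} [NormedAddCommGroup B] [NormedSpace ℝ B]
  {M : Type*} [TopologicalSpace M] [ChartedSpace B M]
  {F : Type*} [NormedAddCommGroup F] [NormedSpace ℝ F]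
  {E : M → Type*} [∀ x, AddCommGroup (E x)] [∀ x, Module ℝ (E x)]
  [∀ x, TopologicalSpace (E x)] [TopologicalSpace (TotalSpace F E)]
  [FiberBundle F E] [VectorBundle ℝ F E]

local notation "𝓡" => C^∞⟮𝓘(ℝ, B), M; ℝ⟯
local notation "Γ" => Cₛ^∞⟮𝓘(ℝ, B); F, E⟯

theorem dirDeriv_congr {f g : 𝓡} {x : M} (h : ∀ᶠ y in 𝓝 x, f y = g y)
    (v : TangentSpace 𝓘(ℝ, B) x) : dirDeriv f x v = dirDeriv g x v := by
  have h1 : mfderiv 𝓘(ℝ, B) 𝓘(ℝ, ℝ) f x = mfderiv 𝓘(ℝ, B) 𝓘(ℝ, ℝ) g x :=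
    Filter.EventuallyEq.mfderiv_eq h
  exact congrArg (fun L => L v) h1

theorem dirDeriv_const (c : ℝ) (x : M) (v : TangentSpace 𝓘(ℝ, B) x) :
    dirDeriv (ContMDiffMap.const c : 𝓡) x v = 0 := by
  have h : mfderiv 𝓘(ℝ, B) 𝓘(ℝ, ℝ) (fun _ : M => c) x = 0 := mfderiv_const
  exact congrArg (fun L => L v) h

theorem dirDeriv_sum {ι : Type*} (s : Finset ι) (f : ι → 𝓡) (x : M)
    (v : TangentSpace 𝓘(ℝ, B) x) : dirDeriv (∑ i ∈ s, f i) x v = ∑ i ∈ s, dirDeriv (f i) x v := by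
  classical
  induction s using Finset.induction_on with
  | empty => exact dirDeriv_const (B := B) 0 x v
  | insert i s hi ih => rw [Finset.sum_insert hi, Finset.sum_insert hi, dirDeriv_add, ih]

theorem sum_function_apply {ι : Type*} [Fintype ι] (f : ι → 𝓡) (x : M) :
    (∑ i, f i) x = ∑ i, f i x := by
  have h : ⇑(∑ i, f i) = ∑ i, ⇑(f i) :=
    map_sum (ContMDiffMap.coeFnAddMonoidHom (I := 𝓘(ℝ, B)) (N := M) (I' := 𝓘(ℝ, ℝ)) (G := ℝ)
      (n := ∞)) f Finset.univ
  rw [h, Finset.sum_apply]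

variable [FiniteDimensional ℝ B] [T2Space M] [IsManifold 𝓘(ℝ, B) ∞ M]

/-- A section vanishing near `x` is annihilated by a function with value `1` at `x`. -/
theorem exists_smul_eq_zero {s : Γ} {x : M} (hs : ∀ᶠ y in 𝓝 x, s y = 0) :
    ∃ g : 𝓡, g x = 1 ∧ g • s = 0 := by
  obtain ⟨u, hu, huo, hxu⟩ := eventually_nhds_iff.1 hs
  obtain ⟨ψ, -, hψ⟩ :=
    (SmoothBumpFunction.nhds_basis_tsupport (I := 𝓘(ℝ, B)) x).mem_iff.1 (huo.mem_nhds hxu)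
  refine ⟨⟨ψ, ψ.contMDiff⟩, ψ.eq_one, ?_⟩
  ext y
  by_cases hy : y ∈ u
  · change ψ y • s y = 0
    rw [hu y hy, smul_zero]
  · have : ψ y = 0 := image_eq_zero_of_notMem_tsupport fun h => hy (hψ h)
    change ψ y • s y = 0
    rw [this, zero_smul]

theorem functional_apply_eq_of_eventuallyEq (l : Γ →ₗ[𝓡] 𝓡) {s t : Γ} {x : M}
    (h : ∀ᶠ y in 𝓝 x, s y = t y) : l s x = l t x := by
  obtain ⟨g, hg, hgs⟩ := exists_smul_eq_zero (s := s - t) (x := x)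
    (h.mono fun y hy => by simp [hy])
  have h1 : l (g • (s - t)) x = g x * (l s x - l t x) := by
    rw [map_smul, map_sub]; rfl
  have h0 : (0 : 𝓡) x = 0 := rfl
  rw [hgs, map_zero, hg, one_mul, h0] at h1
  exact (sub_eq_zero.1 h1.symm)

/-- Apply the Leibniz rule to g (s - t) = 0 with g = 1 at x: the derivative term carries the factor
(s - t) x = 0. This allows a section to be replaced by its local expansion in a frame. -/
theorem GeneralizedConnection.toFun_congr {C : CourantAlgebroid B F E}
    (D : GeneralizedConnection C) {s t : Γ} {x : M}
    (h : ∀ᶠ y in 𝓝 x, s y = t y) : D.toFun s x = D.toFun t x := by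
  obtain ⟨g, hg, hgs⟩ := exists_smul_eq_zero (s := s - t) (x := x)
    (h.mono fun y hy => by simp [hy])
  have hx : (s - t) x = 0 := by simp [h.self_of_nhds]
  ext v
  have h1 := D.leibniz g (s - t) x v
  rw [hgs, map_zero, hg, one_smul, hx, smul_zero, add_zero, map_sub] at h1
  exact (sub_eq_zero.1 h1.symm)

end Locality

/-! ### Local dual frames, representation of functionals, traces -/

section Frames

variable {B : Type*} [NormedAddCommGroup B] [NormedSpace ℝ B]
  {M : Type*} [TopologicalSpace M] [ChartedSpace B M] [IsManifold 𝓘(ℝ, B) ∞ M]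
  {F : Type*} [NormedAddCommGroup F] [NormedSpace ℝ F]
  {E : M → Type*} [∀ x, AddCommGroup (E x)] [∀ x, Module ℝ (E x)]
  [∀ x, TopologicalSpace (E x)] [TopologicalSpace (TotalSpace F E)]
  [FiberBundle F E] [VectorBundle ℝ F E]

local notation "𝓡" => C^∞⟮𝓘(ℝ, B), M; ℝ⟯
local notation "Γ" => Cₛ^∞⟮𝓘(ℝ, B); F, E⟯

namespace CourantAlgebroid

variable (C : CourantAlgebroid B F E)

/-- `e` and `η` are families of sections with `v = ∑ ⟨η i, v⟩ e i` for all `v` in the fibre at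
`x`. -/
def IsDualFrame {n : ℕ} (e η : Fin n → Γ) (x : M) : Prop :=
  ∀ v : E x, ∑ i, C.pairing x (η i x) v • e i x = v

@[simp]
theorem inner_apply (a b : Γ) (x : M) : C.inner a b x = C.pairing x (a x) (b x) := rfl

variable [FiniteDimensional ℝ B] [T2Space M] [FiniteDimensional ℝ F]
  [ContMDiffVectorBundle ∞ F E 𝓘(ℝ, B)]

/-- A local frame from a trivialization is paired with its dual, obtained from the inverse Gram
matrix. Frame and coefficients are replaced by global objects that agree with them near the point,
so all later computations use global sections only. -/
theorem exists_isDualFrame (x₀ : M) :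
    ∃ (n : ℕ) (e η : Fin n → Γ), ∀ᶠ x in 𝓝 x₀, C.IsDualFrame e η x := by
  have : ContMDiffVectorBundle 1 F E 𝓘(ℝ, B) := ContMDiffVectorBundle.of_le (n := ∞) (by simp)
  let t := trivializationAt F E x₀
  have hx₀ : x₀ ∈ t.baseSet := FiberBundle.mem_baseSet_trivializationAt F E x₀
  let b := Module.finBasis ℝ F
  choose e he using fun i => exists_section_eventuallyEq (B := B) t.open_baseSet hx₀
    (t.contMDiffOn_localFrame_baseSet (I := 𝓘(ℝ, B)) ∞ b i)
  have hloc := t.isLocalFrameOn_localFrame_baseSet 𝓘(ℝ, B) 1 b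
  have hframe : ∀ᶠ x in 𝓝 x₀, LinearIndependent ℝ (fun i => e i x) ∧
      ⊤ ≤ Submodule.span ℝ (Set.range fun i => e i x) := by
    filter_upwards [t.open_baseSet.mem_nhds hx₀, Filter.eventually_all.2 he] with x hx h
    have h' : (fun i => e i x) = fun i => t.localFrame b i x := funext h
    rw [h']
    exact ⟨hloc.linearIndependent hx, hloc.generating hx⟩
  obtain ⟨u, hu, huo, hxu⟩ := eventually_nhds_iff.1 hframe
  let A : M → Matrix _ _ ℝ := fun x => .of fun i j => C.pairing x (e i x) (e j x)
  -- A kernel vector of the Gram matrix would give a vector orthogonal to the whole fibre.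
  have hA : ∀ x ∈ u, (A x).det ≠ 0 := by
    intro x hx hdet
    obtain ⟨hli, hsp⟩ := hu x hx
    obtain ⟨v, hv0, hv⟩ := Matrix.exists_mulVec_eq_zero_iff.2 hdet
    have hw : ∑ j, v j • e j x = 0 := by
      refine (C.pairing_nondegenerate x).2 _ fun z => ?_
      have hz : z ∈ Submodule.span ℝ (Set.range fun i => e i x) := hsp trivial
      induction hz using Submodule.span_induction with
      | mem z hz =>
        obtain ⟨i, rfl⟩ := hz
        have := congrFun hv i
        simpa [Matrix.mulVec, dotProduct, A, mul_comm] using this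
      | zero => simp
      | add y z _ _ hy hz => rw [map_add, LinearMap.add_apply, hy, hz, add_zero]
      | smul r y _ hy => rw [map_smul, LinearMap.smul_apply, hy, smul_zero]
    exact hv0 (funext (Fintype.linearIndependent_iff.1 hli v hw))
  have hAs : ∀ x i j, ContMDiffAt 𝓘(ℝ, B) 𝓘(ℝ, ℝ) ∞ (fun x => A x i j) x := fun x i j =>
    (C.pairing_smooth (e i) (e j)).contMDiffAt
  have hinv : ∀ i j, ContMDiffOn 𝓘(ℝ, B) 𝓘(ℝ, ℝ) ∞ (fun x => (A x)⁻¹ i j) u := by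
    intro i j x hx
    refine ContMDiffAt.contMDiffWithinAt ?_
    -- The cofactor formula exhibits the entries of the inverse as quotients of determinants, hence
    -- smooth.
    have : (fun x => (A x)⁻¹ i j) =
        fun x => ((A x).det)⁻¹ * ((A x).updateRow j (Pi.single i 1)).det := by
      ext y
      rw [Matrix.inv_def, Ring.inverse_eq_inv', Matrix.smul_apply, smul_eq_mul,
        Matrix.adjugate_apply]
    rw [this]
    refine ((GeneralizedMetric.contMDiffAt_det (hAs x)).inv₀ (hA x hx)).mul
      (GeneralizedMetric.contMDiffAt_det fun p q => ?_)
    by_cases hp : p = j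
    · subst hp
      simpa only [Matrix.updateRow_self] using contMDiffAt_const
    · simpa only [Matrix.updateRow_ne hp] using hAs x p q
  choose c hc using fun i j => exists_function_eventuallyEq (B := B) huo hxu (hinv i j)
  refine ⟨_, e, fun i => ∑ j, c i j • e j, ?_⟩
  filter_upwards [huo.mem_nhds hxu, Filter.eventually_all.2 fun i =>
    Filter.eventually_all.2 (hc i)] with x hx hcx v
  have hv : v ∈ Submodule.span ℝ (Set.range fun i => e i x) := (hu x hx).2 trivial
  have hdual : ∀ i k, C.pairing x ((∑ j, c i j • e j) x) (e k x) = if i = k then 1 else 0 := by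
    intro i k
    have h1 := congrFun (congrFun (Matrix.nonsing_inv_mul (A x) (isUnit_iff_ne_zero.2 (hA x hx))) i) k
    rw [Matrix.mul_apply, Matrix.one_apply] at h1
    rw [← h1, sum_section_apply, map_sum, LinearMap.sum_apply]
    refine Finset.sum_congr rfl fun j _ => ?_
    rw [smul_section_apply, map_smul, LinearMap.smul_apply, hcx, smul_eq_mul]
    rfl
  induction hv using Submodule.span_induction with
  | mem z hz =>
    obtain ⟨k, rfl⟩ := hz
    simp only [hdual, ite_smul, one_smul, zero_smul]
    simp
  | zero => simp
  | add y z _ _ hy hz =>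
    simp only [map_add, add_smul, Finset.sum_add_distrib, hy, hz]
  | smul r y _ hy =>
    simp only [map_smul, smul_assoc, ← Finset.smul_sum, hy]

variable {C}

/-- The dual frame relation writes L as the sum of the rank-one maps v ↦ ⟨η i, v⟩ L (e i).
Independence of the frame plays no role. -/
theorem IsDualFrame.trace_eq {n : ℕ} {e η : Fin n → Γ} {x : M} (h : C.IsDualFrame e η x)
    (L : E x →ₗ[ℝ] E x) :
    LinearMap.trace ℝ (E x) L = ∑ i, C.pairing x (η i x) (L (e i x)) := by
  have : FiniteDimensional ℝ (E x) := VectorBundle.finiteDimensional ℝ F E x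
  have hL : L = ∑ i, (C.pairing x (η i x)).smulRight (L (e i x)) := by
    ext v
    conv_lhs => rw [← h v]
    simp [map_sum, LinearMap.sum_apply]
  conv_lhs => rw [hL]
  rw [map_sum]
  exact Finset.sum_congr rfl fun i _ => LinearMap.trace_smulRight _ _

theorem eventuallyEq_sum_of_isDualFrame {n : ℕ} {e η : Fin n → Γ} {x : M}
    (h : ∀ᶠ y in 𝓝 x, C.IsDualFrame e η y) (s : Γ) :
    ∀ᶠ y in 𝓝 x, s y = (∑ i, C.inner (η i) s • e i) y := by
  filter_upwards [h] with y hy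
  rw [sum_section_apply]
  exact (hy (s y)).symm

theorem functional_eq_sum {n : ℕ} {e η : Fin n → Γ} {x : M}
    (h : ∀ᶠ y in 𝓝 x, C.IsDualFrame e η y) (l : Γ →ₗ[𝓡] 𝓡) (s : Γ) :
    l s x = ∑ i, C.pairing x (η i x) (s x) * l (e i) x := by
  rw [functional_apply_eq_of_eventuallyEq l (eventuallyEq_sum_of_isDualFrame h s), map_sum,
    sum_function_apply]
  refine Finset.sum_congr rfl fun i _ => ?_
  rw [map_smul]
  rfl

theorem pairing_ext {x : M} {v w : E x} (h : ∀ z, C.pairing x v z = C.pairing x w z) : v = w := by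
  refine sub_eq_zero.1 ((C.pairing_nondegenerate x).1 _ fun z => ?_)
  rw [map_sub, LinearMap.sub_apply, h, sub_self]

variable (C)

/-- Every `C^∞(M)`-linear functional on `Γ(E)` is the pairing with a section. -/
theorem exists_inner_eq (l : Γ →ₗ[𝓡] 𝓡) : ∃ s : Γ, ∀ t, C.inner s t = l t := by
  have key : ∀ x₀ : M, ∃ s : Γ, ∀ᶠ x in 𝓝 x₀, ∀ t : Γ, C.pairing x (s x) (t x) = l t x := by
    intro x₀
    obtain ⟨n, e, η, h⟩ := C.exists_isDualFrame x₀
    refine ⟨∑ i, l (e i) • η i, ?_⟩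
    -- The expansion of l at x needs the frame relation on a neighbourhood of x, not only at x.
    filter_upwards [eventually_eventually_nhds.2 h] with x hx t
    rw [functional_eq_sum hx, sum_section_apply, map_sum, LinearMap.sum_apply]
    refine Finset.sum_congr rfl fun i _ => ?_
    rw [smul_section_apply, map_smul, LinearMap.smul_apply, smul_eq_mul, mul_comm]
  choose s hs using key
  -- The local representatives glue: by nondegeneracy, the value at x is determined by l, so near x₀
  -- the diagonal section coincides with the smooth section s x₀.
  refine ⟨⟨fun x => s x x, fun x₀ => ?_⟩, fun t => ?_⟩
  · refine (s x₀).contMDiff.contMDiffAt.congr_of_eventuallyEq ?_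
    filter_upwards [hs x₀] with x hx
    congr 1
    refine pairing_ext (C := C) fun z => ?_
    obtain ⟨c, rfl⟩ := exists_section_apply_eq (B := B) (F := F) z
    rw [hx, (hs x).self_of_nhds]
  · ext x
    exact (hs x).self_of_nhds t

/-- The section representing a `C^∞(M)`-linear functional on `Γ(E)` through the pairing. -/
def riesz (l : Γ →ₗ[𝓡] 𝓡) : Γ := (C.exists_inner_eq l).choose

theorem inner_riesz (l : Γ →ₗ[𝓡] 𝓡) (t : Γ) : C.inner (C.riesz l) t = l t :=
  (C.exists_inner_eq l).choose_spec t

theorem pairing_riesz (l : Γ →ₗ[𝓡] 𝓡) (t : Γ) (x : M) :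
    C.pairing x (C.riesz l x) (t x) = l t x :=
  congrArg (fun f : 𝓡 => f x) (C.inner_riesz l t)

/-- The trace of a `C^∞(M)`-linear endomorphism of `Γ(E)` is smooth. -/
theorem contMDiff_trace_fibreMap (C : CourantAlgebroid B F E) (Φ : Γ →ₗ[𝓡] Γ) :
    ContMDiff 𝓘(ℝ, B) 𝓘(ℝ, ℝ) ∞ fun x => LinearMap.trace ℝ (E x) (fibreMap Φ x) := by
  intro x₀
  obtain ⟨n, e, η, h⟩ := C.exists_isDualFrame x₀
  refine (∑ i, C.inner (η i) (Φ (e i))).contMDiff.contMDiffAt.congr_of_eventuallyEq ?_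
  filter_upwards [h] with x hx
  rw [hx.trace_eq, sum_function_apply]
  refine Finset.sum_congr rfl fun i _ => ?_
  rw [fibreMap_apply]
  rfl

end CourantAlgebroid

/-! ### Traces of covariant derivatives -/

namespace GeneralizedConnection

variable [FiniteDimensional ℝ B] [T2Space M] [FiniteDimensional ℝ F]
  [ContMDiffVectorBundle ∞ F E 𝓘(ℝ, B)] {C : CourantAlgebroid B F E}
  (D : GeneralizedConnection C)

theorem cov_apply (a b : Γ) (x : M) : D.cov a b x = D.toFun b x (a x) := rfl

/-- The dual frame relation is parallel. -/
theorem sum_isDualFrame_eq_zero {n : ℕ} {e η : Fin n → Γ} {x : M}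
    (h : ∀ᶠ y in 𝓝 x, C.IsDualFrame e η y) (v w : E x) :
    ∑ i, (C.pairing x (D.toFun (η i) x v) w • e i x +
      C.pairing x (η i x) w • D.toFun (e i) x v) = 0 := by
  obtain ⟨s, rfl⟩ := exists_section_apply_eq (B := B) (F := F) w
  -- Differentiating s = ∑ ⟨η i, s⟩ e i by the Leibniz rule and compatibility gives three sums. The
  -- one that differentiates s reproduces D_v s, so the other two cancel.
  have h1 : D.toFun s x v = ∑ i, (C.pairing x (D.toFun (η i) x v) (s x) • e i x +
      C.pairing x (η i x) (s x) • D.toFun (e i) x v) +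
      ∑ i, C.pairing x (η i x) (D.toFun s x v) • e i x := by
    conv_lhs => rw [D.toFun_congr (CourantAlgebroid.eventuallyEq_sum_of_isDualFrame h s)]
    rw [map_sum, Finset.sum_apply, LinearMap.sum_apply, ← Finset.sum_add_distrib]
    refine Finset.sum_congr rfl fun i _ => ?_
    rw [D.leibniz, D.compatible, CourantAlgebroid.inner_apply]
    module
  rw [h.self_of_nhds] at h1
  simpa using h1

/-- The trace commutes with covariant derivatives. -/
theorem trace_covariant_derivative (a : Γ) (Φ Ψ : Γ →ₗ[𝓡] Γ)
    (hΨ : ∀ c, Ψ c = D.cov a (Φ c) - Φ (D.cov a c)) (f : 𝓡)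
    (hf : ∀ x, f x = LinearMap.trace ℝ (E x) (fibreMap Φ x)) (x : M) :
    LinearMap.trace ℝ (E x) (fibreMap Ψ x) = dirDeriv f x (C.anchor x (a x)) := by
  have : FiniteDimensional ℝ (E x) := VectorBundle.finiteDimensional ℝ F E x
  obtain ⟨n, e, η, h⟩ := C.exists_isDualFrame x
  have hx := h.self_of_nhds
  have hf' : ∀ᶠ y in 𝓝 x, f y = (∑ i, C.inner (η i) (Φ (e i))) y := by
    filter_upwards [h] with y hy
    rw [hf, hy.trace_eq, sum_function_apply]
    refine Finset.sum_congr rfl fun i _ => ?_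
    rw [fibreMap_apply]
    rfl
  -- The contributions from differentiating the frame cancel in the derivative of ∑ ⟨η i, Φ (e i)⟩:
  -- compose the parallel relation for ∑ η i ⊗ e i with Φ and take the trace.
  have h0 : ∑ i, (C.pairing x (D.toFun (η i) x (a x)) (Φ (e i) x) +
      C.pairing x (η i x) (Φ (D.cov a (e i)) x)) = 0 := by
    have hL : ∑ i, ((C.pairing x (D.toFun (η i) x (a x))).smulRight (e i x) +
        (C.pairing x (η i x)).smulRight (D.cov a (e i) x)) = 0 := by
      ext w
      rw [LinearMap.sum_apply]
      exact D.sum_isDualFrame_eq_zero h (a x) w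
    have h1 := congrArg (LinearMap.trace ℝ (E x) ∘ₗ LinearMap.mulLeft ℝ (fibreMap Φ x)) hL
    have h2 : ∀ (l : E x →ₗ[ℝ] ℝ) (s : Γ), (LinearMap.trace ℝ (E x) ∘ₗ
        LinearMap.mulLeft ℝ (fibreMap Φ x)) (l.smulRight (s x)) = l (Φ s x) := fun l s => by
      have h3 : fibreMap Φ x * l.smulRight (s x) = l.smulRight (Φ s x) := by
        ext w
        change fibreMap Φ x (l w • s x) = l w • Φ s x
        rw [map_smul, fibreMap_apply]
      change LinearMap.trace ℝ (E x) (fibreMap Φ x * l.smulRight (s x)) = _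
      rw [h3, LinearMap.trace_smulRight]
    simp only [map_sum, map_add, map_zero, h2] at h1
    exact h1
  rw [dirDeriv_congr hf', dirDeriv_sum, hx.trace_eq, ← sub_eq_zero, ← Finset.sum_sub_distrib,
    ← neg_eq_zero, ← Finset.sum_neg_distrib, ← h0]
  refine Finset.sum_congr rfl fun i _ => ?_
  rw [fibreMap_apply, hΨ, D.compatible]
  simp only [ContMDiffSection.coe_sub, Pi.sub_apply, map_sub, cov_apply]
  ring

end GeneralizedConnection

end Frames

/-! ### Existence of generalized connections -/

section Connections

variable {B : Type*} [NormedAddCommGroup B] [NormedSpace ℝ B]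
  {M : Type*} [TopologicalSpace M] [ChartedSpace B M] [IsManifold 𝓘(ℝ, B) ∞ M]
  {F : Type*} [NormedAddCommGroup F] [NormedSpace ℝ F]
  {E : M → Type*} [∀ x, AddCommGroup (E x)] [∀ x, Module ℝ (E x)]
  [∀ x, TopologicalSpace (E x)] [TopologicalSpace (TotalSpace F E)]
  [FiberBundle F E] [VectorBundle ℝ F E]
  [FiniteDimensional ℝ B] [T2Space M] [FiniteDimensional ℝ F]
  [ContMDiffVectorBundle ∞ F E 𝓘(ℝ, B)]

local notation "𝓡" => C^∞⟮𝓘(ℝ, B), M; ℝ⟯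
local notation "Γ" => Cₛ^∞⟮𝓘(ℝ, B); F, E⟯

/-- The differential `df` at `x` as a linear map. -/
def dirDerivLinear (f : 𝓡) (x : M) : TangentSpace 𝓘(ℝ, B) x →ₗ[ℝ] ℝ where
  toFun := dirDeriv f x
  map_add' v w := map_add (mfderiv 𝓘(ℝ, B) 𝓘(ℝ, ℝ) f x) v w
  map_smul' c v := map_smul (mfderiv 𝓘(ℝ, B) 𝓘(ℝ, ℝ) f x) c v

theorem dirDeriv_add_vector (f : 𝓡) (x : M) (v w : TangentSpace 𝓘(ℝ, B) x) :
    dirDeriv f x (v + w) = dirDeriv f x v + dirDeriv f x w :=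
  map_add (dirDerivLinear f x) v w

namespace CourantAlgebroid

variable (C : CourantAlgebroid B F E)

/-- The connection for which the sections `e i` of a dual frame are constant, at the point `x`. -/
def frameDeriv {n : ℕ} (e η : Fin n → Γ) (s : Γ) (x : M) : E x →ₗ[ℝ] E x :=
  ∑ i, (dirDerivLinear (C.inner (η i) s) x ∘ₗ C.anchor x).smulRight (e i x)

theorem frameDeriv_apply {n : ℕ} (e η : Fin n → Γ) (s : Γ) (x : M) (v : E x) :
    C.frameDeriv e η s x v = ∑ i, dirDeriv (C.inner (η i) s) x (C.anchor x v) • e i x := by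
  rw [frameDeriv, LinearMap.sum_apply]
  rfl

theorem inner_add_right (a b c : Γ) : C.inner a (b + c) = C.inner a b + C.inner a c := by
  ext x
  exact map_add (C.pairing x (a x)) (b x) (c x)

theorem inner_smul_right (f : 𝓡) (a b : Γ) : C.inner a (f • b) = f * C.inner a b := by
  ext x
  exact map_smul (C.pairing x (a x)) (f x) (b x)

theorem frameDeriv_add {n : ℕ} (e η : Fin n → Γ) (s t : Γ) (x : M) :
    C.frameDeriv e η (s + t) x = C.frameDeriv e η s x + C.frameDeriv e η t x := by
  ext v
  simp only [frameDeriv_apply, LinearMap.add_apply, inner_add_right, dirDeriv_add, add_smul,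
    Finset.sum_add_distrib]

theorem frameDeriv_smul {n : ℕ} {e η : Fin n → Γ} {x : M} (h : C.IsDualFrame e η x) (f : 𝓡)
    (s : Γ) (v : E x) : C.frameDeriv e η (f • s) x v =
      f x • C.frameDeriv e η s x v + dirDeriv f x (C.anchor x v) • s x := by
  -- This is the only use of the frame relation: where it fails, the zeroth-order terms do not
  -- reassemble to s.
  conv_rhs => rw [← h (s x)]
  simp only [frameDeriv_apply, Finset.smul_sum, ← Finset.sum_add_distrib]
  refine Finset.sum_congr rfl fun i _ => ?_
  rw [inner_smul_right, dirDeriv_mul, inner_apply]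
  module

theorem frameDeriv_const_smul {n : ℕ} (e η : Fin n → Γ) (c : ℝ) (s : Γ) (x : M) :
    C.frameDeriv e η (c • s) x = c • C.frameDeriv e η s x := by
  ext v
  have h : c • s = (ContMDiffMap.const c : 𝓡) • s := rfl
  rw [h, LinearMap.smul_apply]
  simp only [frameDeriv_apply, Finset.smul_sum]
  refine Finset.sum_congr rfl fun i _ => ?_
  rw [inner_smul_right, dirDeriv_mul, dirDeriv_const, mul_zero, add_zero, mul_smul]
  rfl

/-- The derivative of f along ρ a, times e, equals [a, f e] - f [a, e], which is a smooth section by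
construction; no separate smoothness argument for derivatives along the anchor is needed. -/
theorem contMDiff_frameDeriv {n : ℕ} (e η : Fin n → Γ) (s a : Γ) :
    ContMDiff 𝓘(ℝ, B) (𝓘(ℝ, B).prod 𝓘(ℝ, F)) ∞
      fun x => TotalSpace.mk' F x (C.frameDeriv e η s x (a x)) := by
  have h : ∀ x, C.frameDeriv e η s x (a x) =
      (∑ i, (C.bracket a (C.inner (η i) s • e i) - C.inner (η i) s • C.bracket a (e i))) x := by
    intro x
    rw [frameDeriv_apply, sum_section_apply]
    refine Finset.sum_congr rfl fun i _ => ?_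
    rw [ContMDiffSection.coe_sub, Pi.sub_apply, C.bracket_smul, smul_section_apply,
      add_sub_cancel_left]
  simp only [h]
  exact ContMDiffSection.contMDiff _

/-- `E` admits a connection along the anchor. -/
theorem exists_connection [SecondCountableTopology M] :
    ∃ N : Γ →ₗ[ℝ] ∀ x, (E x →ₗ[ℝ] E x),
      (∀ a b : Γ, ContMDiff 𝓘(ℝ, B) (𝓘(ℝ, B).prod 𝓘(ℝ, F)) ∞
        fun x => TotalSpace.mk' F x (N a x (b x))) ∧
      ∀ (f : 𝓡) (a : Γ) (x : M) (v : E x),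
        N (f • a) x v = f x • N a x v + dirDeriv f x (C.anchor x v) • a x := by
  choose n e η h using C.exists_isDualFrame
  choose U hU hUo hxU using fun x₀ => eventually_nhds_iff.1 (h x₀)
  have : LocallyCompactSpace M := ChartedSpace.locallyCompactSpace B M
  obtain ⟨φ, hφ⟩ := SmoothPartitionOfUnity.exists_isSubordinate 𝓘(ℝ, B) isClosed_univ U hUo
    fun x _ => Set.mem_iUnion.2 ⟨x, hxU x⟩
  refine ⟨⟨⟨fun s x => ∑ i ∈ φ.finsupport x, φ i x • C.frameDeriv (e i) (η i) s x, ?_⟩, ?_⟩,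
    ?_, ?_⟩
  · intro s t
    ext1 x
    simp only [frameDeriv_add, smul_add, Finset.sum_add_distrib, Pi.add_apply]
  · intro c s
    ext1 x
    simp only [frameDeriv_const_smul, Finset.smul_sum, Pi.smul_apply, RingHom.id_apply]
    exact Finset.sum_congr rfl fun i _ => smul_comm _ _ _
  · intro s a
    have hs : ∀ i, ContMDiff 𝓘(ℝ, B) (𝓘(ℝ, B).prod 𝓘(ℝ, F)) ∞
        fun x => TotalSpace.mk' F x (φ i x • C.frameDeriv (e i) (η i) s x (a x)) := fun i =>
      (φ i).contMDiff.smul_section (C.contMDiff_frameDeriv (e i) (η i) s a)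
    have hsum := ContMDiff.finsum_section_of_locallyFinite
      (φ.locallyFinite.subset fun i x hx => left_ne_zero_of_smul hx) hs
    convert hsum using 3 with x
    have := φ.sum_finsupport_smul_eq_finsum x (A := E x)
      fun i _ => C.frameDeriv (e i) (η i) s x (a x)
    rw [← this]
    simp
  · intro f s x v
    -- Each local derivative obeys the Leibniz rule only where its frame is dual; subordination puts
    -- x there for every index contributing at x.
    have hmem : ∀ i ∈ φ.finsupport x, C.IsDualFrame (e i) (η i) x := fun i hi =>
      hU i x (hφ i (subset_closure ((φ.mem_finsupport x).1 hi)))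
    have h1 := φ.sum_finsupport x (Set.mem_univ x)
    simp only [LinearMap.coe_mk, AddHom.coe_mk, LinearMap.sum_apply, LinearMap.smul_apply]
    -- The inhomogeneous Leibniz terms add up to one copy because the weights sum to 1.
    rw [← one_smul ℝ (dirDeriv f x (C.anchor x v) • s x), ← h1, Finset.sum_smul, Finset.smul_sum,
      ← Finset.sum_add_distrib]
    refine Finset.sum_congr rfl fun i hi => ?_
    rw [C.frameDeriv_smul (hmem i hi)]
    module

end CourantAlgebroid

namespace GeneralizedConnection

variable {C : CourantAlgebroid B F E}

/-- A generalized connection from its action on sections. -/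
def ofTensorial (N : Γ → Γ →ₗ[𝓡] Γ) (hadd : ∀ b c, N (b + c) = N b + N c)
    (hleib : ∀ (f : 𝓡) (b a : Γ) (x : M),
      N (f • b) a x = f x • N b a x + dirDeriv f x (C.anchor x (a x)) • b x)
    (hcompat : ∀ (b c a : Γ) (x : M), dirDeriv (C.inner b c) x (C.anchor x (a x)) =
      C.pairing x (N b a x) (c x) + C.pairing x (b x) (N c a x)) :
    GeneralizedConnection C where
  toFun :=
    { toFun := fun b x => fibreMap (N b) x
      map_add' := fun b c => by
        ext x v
        obtain ⟨a, rfl⟩ := exists_section_apply_eq (B := B) (F := F) v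
        simp only [Pi.add_apply, LinearMap.add_apply, fibreMap_apply, hadd]
        rfl
      map_smul' := fun r b => by
        ext x v
        obtain ⟨a, rfl⟩ := exists_section_apply_eq (B := B) (F := F) v
        simp only [Pi.smul_apply, LinearMap.smul_apply, fibreMap_apply, RingHom.id_apply]
        have h : r • b = (ContMDiffMap.const r : 𝓡) • b := rfl
        rw [h, hleib, dirDeriv_const, zero_smul, add_zero]
        rfl }
  smooth b a := by
    have h : ∀ x, fibreMap (N b) x (a x) = N b a x := fun x => fibreMap_apply _ _ _
    simp only [LinearMap.coe_mk, AddHom.coe_mk, h]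
    exact (N b a).contMDiff
  leibniz f b x v := by
    obtain ⟨a, rfl⟩ := exists_section_apply_eq (B := B) (F := F) v
    simp only [LinearMap.coe_mk, AddHom.coe_mk, fibreMap_apply]
    exact hleib f b a x
  compatible b c x v := by
    obtain ⟨a, rfl⟩ := exists_section_apply_eq (B := B) (F := F) v
    simp only [LinearMap.coe_mk, AddHom.coe_mk, fibreMap_apply]
    exact hcompat b c a x

theorem ofTensorial_cov (N : Γ → Γ →ₗ[𝓡] Γ) (hadd) (hleib) (hcompat) (a b : Γ) :
    (ofTensorial (C := C) N hadd hleib hcompat).cov a b = N b a := by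
  ext x
  exact fibreMap_apply (N b) a x

/-- Every Courant algebroid admits a generalized connection. -/
theorem nonempty [SecondCountableTopology M] (C : CourantAlgebroid B F E) :
    Nonempty (GeneralizedConnection C) := by
  obtain ⟨P, hP, hPleib⟩ := C.exists_connection
  let cov : Γ → Γ → Γ := fun b a => ⟨fun x => P b x (a x), hP b a⟩
  -- This functional represents the average of P with its dual connection. The derivative of ⟨b, c⟩
  -- along ρ a is written through brackets, by invariance, so that its value is visibly a smooth
  -- function; `hl` restores the derivative.
  let l : Γ → Γ → Γ →ₗ[𝓡] 𝓡 := fun b a =>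
    { toFun := fun c => (1 / 2 : ℝ) • (C.inner (cov b a) c - C.inner b (cov c a) +
        (C.inner (C.bracket a b) c + C.inner b (C.bracket a c)))
      map_add' := fun c d => by
        have h : cov (c + d) a = cov c a + cov d a := by
          ext x
          change P (c + d) x (a x) = P c x (a x) + P d x (a x)
          rw [map_add]; rfl
        simp only [h, C.inner_add_right, map_add, ← smul_add]
        congr 1
        ring
      map_smul' := fun f c => by
        ext x
        have h1 : cov (f • c) a x = _ := hPleib f c x (a x)
        have h2 := C.bracket_smul f a c x
        change (1 / 2 : ℝ) * (C.pairing x (cov b a x) (f x • c x) -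
          C.pairing x (b x) (cov (f • c) a x) + (C.pairing x (C.bracket a b x) (f x • c x) +
          C.pairing x (b x) (C.bracket a (f • c) x))) = f x * ((1 / 2 : ℝ) *
          (C.pairing x (cov b a x) (c x) - C.pairing x (b x) (P c x (a x)) +
          (C.pairing x (C.bracket a b x) (c x) + C.pairing x (b x) (C.bracket a c x))))
        rw [h1, h2]
        simp only [map_add, map_smul, smul_eq_mul]
        ring }
  have hl : ∀ (b a c : Γ) (x : M), C.pairing x (C.riesz (l b a) x) (c x) =
      (1 / 2 : ℝ) * (C.pairing x (P b x (a x)) (c x) - C.pairing x (b x) (P c x (a x)) +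
        dirDeriv (C.inner b c) x (C.anchor x (a x))) := fun b a c x => by
    rw [C.pairing_riesz]
    have h : dirDeriv (C.inner b c) x (C.anchor x (a x)) = _ := C.invariant a b c x
    rw [h]
    rfl
  have hext : ∀ {x : M} {v w : E x},
      (∀ c : Γ, C.pairing x v (c x) = C.pairing x w (c x)) → v = w := fun h =>
    CourantAlgebroid.pairing_ext (C := C) fun z => by
      obtain ⟨c, rfl⟩ := exists_section_apply_eq (B := B) (F := F) z
      exact h c
  refine ⟨ofTensorial (fun b =>
    { toFun := fun a => C.riesz (l b a)
      map_add' := fun a a' => ?_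
      map_smul' := fun f a => ?_ }) (fun b b' => ?_) (fun f b a x => ?_) fun b c a x => ?_⟩
  · ext x
    refine hext fun c => ?_
    simp only [ContMDiffSection.coe_add, Pi.add_apply, map_add, LinearMap.add_apply, hl,
      dirDeriv_add_vector]
    ring
  · ext x
    refine hext fun c => ?_
    have h : dirDeriv (C.inner b c) x (f x • C.anchor x (a x)) =
        f x * dirDeriv (C.inner b c) x (C.anchor x (a x)) :=
      map_smul (dirDerivLinear (C.inner b c) x) _ _
    simp only [smul_section_apply, map_smul, LinearMap.smul_apply, hl, h, smul_eq_mul,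
      RingHom.id_apply]
    ring
  · ext a x
    refine hext fun c => ?_
    change C.pairing x (C.riesz (l (b + b') a) x) (c x) =
      C.pairing x (C.riesz (l b a) x + C.riesz (l b' a) x) (c x)
    have h : C.inner (b + b') c = C.inner b c + C.inner b' c := by
      ext y
      exact LinearMap.map_add₂ (C.pairing y) (b y) (b' y) (c y)
    simp only [map_add, LinearMap.add_apply, hl, h, dirDeriv_add, ContMDiffSection.coe_add,
      Pi.add_apply]
    ring
  · refine hext fun c => ?_
    change C.pairing x (C.riesz (l (f • b) a) x) (c x) =
      C.pairing x (f x • C.riesz (l b a) x + dirDeriv f x (C.anchor x (a x)) • b x) (c x)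
    have h : C.inner (f • b) c = f * C.inner b c := by
      ext y
      exact LinearMap.map_smul₂ (C.pairing y) (f y) (b y) (c y)
    simp only [map_add, LinearMap.add_apply, map_smul, LinearMap.smul_apply, hl, h, hPleib,
      dirDeriv_mul, smul_section_apply, CourantAlgebroid.inner_apply, smul_eq_mul]
    ring
  · change _ = C.pairing x (C.riesz (l b a) x) (c x) + C.pairing x (b x) (C.riesz (l c a) x)
    have h : C.inner c b = C.inner b c := by
      ext y
      exact C.pairing_symm y _ _
    rw [C.pairing_symm x (b x), hl, hl, h, C.pairing_symm x (c x), C.pairing_symm x (P c x (a x))]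
    ring

end GeneralizedConnection

theorem Sgn.opp_opp (σ : Sgn) : σ.opp.opp = σ := by cases σ <;> rfl

/-! ### Projections to V_± and the connection with bracket mixed derivatives -/

namespace GeneralizedMetric

variable {C : CourantAlgebroid B F E} (G : GeneralizedMetric C)

theorem fibreProj_eq_zero_of_mem {σ : Sgn} {x : M} {v : E x} (hv : v ∈ G.part σ x) :
    G.fibreProj σ.opp x v = 0 :=
  G.fibreProj_of_mem_opp (by rwa [Sgn.opp_opp])

theorem fibreProj_add_opp (σ : Sgn) (x : M) (v : E x) :
    G.fibreProj σ x v + G.fibreProj σ.opp x v = v := by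
  cases σ with
  | pos => exact G.fibreProj_pos_add_neg x v
  | neg => rw [add_comm]; exact G.fibreProj_pos_add_neg x v

theorem pairing_opp_eq_zero {σ : Sgn} {x : M} {v w : E x} (hv : v ∈ G.part σ.opp x)
    (hw : w ∈ G.part σ x) : C.pairing x v w = 0 := by
  rw [C.pairing_symm]
  exact G.pairing_eq_zero σ hw hv

theorem pairing_fibreProj_of_mem {σ : Sgn} {x : M} (v : E x) {w : E x} (hw : w ∈ G.part σ x) :
    C.pairing x (G.fibreProj σ x v) w = C.pairing x v w := by
  conv_rhs => rw [← G.fibreProj_add_opp σ x v, map_add, LinearMap.add_apply,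
    G.pairing_opp_eq_zero (G.fibreProj_mem σ.opp x v) hw, add_zero]

theorem pairing_fibreProj_right (σ : Sgn) (x : M) (v w : E x) :
    C.pairing x v (G.fibreProj σ x w) = C.pairing x (G.fibreProj σ x v) w := by
  rw [← G.pairing_fibreProj_of_mem v (G.fibreProj_mem σ x w), C.pairing_symm,
    G.pairing_fibreProj_of_mem w (G.fibreProj_mem σ x v), C.pairing_symm]

theorem pairing_eq_add (x : M) (v w : E x) : C.pairing x v w =
    C.pairing x (G.fibreProj .pos x v) (G.fibreProj .pos x w) +
      C.pairing x (G.fibreProj .neg x v) (G.fibreProj .neg x w) := by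
  rw [← G.pairing_fibreProj_right, ← G.pairing_fibreProj_right,
    G.fibreProj_of_mem (G.fibreProj_mem _ _ _), G.fibreProj_of_mem (G.fibreProj_mem _ _ _),
    ← map_add, G.fibreProj_pos_add_neg]

/-- The component `a_±` as a section of `E`. -/
def component (σ : Sgn) : Γ →ₗ[𝓡] Γ := (G.sections σ).subtype ∘ₗ G.proj σ

theorem component_apply (σ : Sgn) (a : Γ) (x : M) :
    G.component σ a x = G.fibreProj σ x (a x) := rfl

theorem component_mem (σ : Sgn) (a : Γ) : G.component σ a ∈ G.sections σ := (G.proj σ a).2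

theorem component_of_mem {σ : Sgn} {a : Γ} (ha : a ∈ G.sections σ) : G.component σ a = a := by
  ext x
  exact G.fibreProj_of_mem (ha x)

theorem component_opp_of_mem {σ : Sgn} {a : Γ} (ha : a ∈ G.sections σ) :
    G.component σ.opp a = 0 := by
  ext x
  exact G.fibreProj_eq_zero_of_mem (ha x)

theorem component_of_mem_opp {σ : Sgn} {a : Γ} (ha : a ∈ G.sections σ.opp) :
    G.component σ a = 0 := by
  ext x
  exact G.fibreProj_of_mem_opp (ha x)

theorem component_add_opp (σ : Sgn) (a : Γ) : G.component σ a + G.component σ.opp a = a := by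
  ext x
  exact G.fibreProj_add_opp σ x (a x)

theorem fibreMap_component (σ : Sgn) (x : M) :
    fibreMap (G.component σ) x = G.fibreProj σ x := by
  ext v
  obtain ⟨a, rfl⟩ := exists_section_apply_eq (B := B) (F := F) v
  rw [fibreMap_apply, component_apply]

theorem trace_fibreProj (σ : Sgn) (x : M) :
    LinearMap.trace ℝ (E x) (G.fibreProj σ x) = Module.finrank ℝ (G.part σ x) := by
  have : FiniteDimensional ℝ (E x) := VectorBundle.finiteDimensional ℝ F E x
  exact LinearMap.IsProj.trace ⟨G.fibreProj_mem σ x, fun v hv => G.fibreProj_of_mem hv⟩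

/-- The rank is the trace of the projection, a smooth endomorphism. It enters the weights of the
divergence correction. -/
theorem contMDiff_finrank (σ : Sgn) :
    ContMDiff 𝓘(ℝ, B) 𝓘(ℝ, ℝ) ∞ fun x => (Module.finrank ℝ (G.part σ x) : ℝ) := by
  simpa only [fibreMap_component, trace_fibreProj] using
    C.contMDiff_trace_fibreMap (G.component σ)

/-- The restriction to one sign of the connection with pure-type torsion:
`a ↦ [a_∓, b_±]_± + (D_{a_±} b_±)_±`. -/
def pureCov (D : GeneralizedConnection C) (σ : Sgn) (b : Γ) : Γ →ₗ[𝓡] Γ where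
  toFun a := G.component σ (C.bracket (G.component σ.opp a) (G.component σ b) +
    D.cov (G.component σ a) (G.component σ b))
  map_add' a a' := by
    ext x
    simp only [map_add, ContMDiffSection.coe_add, Pi.add_apply, component_apply,
      D.cov_apply, LinearMap.add_apply]
    abel
  map_smul' f a := by
    ext x
    -- The bracket fails to be linear in a_∓ only by a multiple of a_∓, which the projection to V_±
    -- kills.
    have h := C.smul_bracket f (a := G.component σ.opp a) (b := G.component σ b)
      (fun y => G.pairing_opp_eq_zero (G.component_mem _ a y) (G.component_mem _ b y)) x
    have h0 : G.fibreProj σ x (G.component σ.opp a x) = 0 :=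
      G.fibreProj_of_mem_opp (G.component_mem _ a x)
    simp only [map_add, map_smul, ContMDiffSection.coe_add, Pi.add_apply, component_apply,
      smul_section_apply, D.cov_apply, h, map_sub, RingHom.id_apply] at h0 ⊢
    rw [h0]
    module

theorem pureCov_apply (D : GeneralizedConnection C) (σ : Sgn) (b a : Γ) (x : M) :
    G.pureCov D σ b a x = G.fibreProj σ x (C.bracket (G.component σ.opp a) (G.component σ b) x +
      D.toFun (G.component σ b) x (G.fibreProj σ x (a x))) := rfl

theorem pureCov_mem (D : GeneralizedConnection C) (σ : Sgn) (b a : Γ) :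
    G.pureCov D σ b a ∈ G.sections σ := G.component_mem _ _

theorem pureCov_eq_zero (D : GeneralizedConnection C) (σ : Sgn) {b : Γ} (hb : b ∈ G.sections σ.opp)
    (a : Γ) : G.pureCov D σ b a = 0 := by
  ext x
  rw [pureCov_apply, G.component_of_mem_opp hb]
  simp

theorem anchor_component (σ : Sgn) (a : Γ) (x : M) : C.anchor x (a x) =
    C.anchor x (G.component σ.opp a x) + C.anchor x (G.component σ a x) := by
  rw [← map_add, add_comm]
  exact congrArg (C.anchor x) (G.fibreProj_add_opp σ x (a x)).symm

/-- The bracket contributes the derivative of f along ρ a_∓, and D the derivative along ρ a_±;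
together they give the one along ρ a. The compatibility with the pairing splits in the same way. -/
theorem pureCov_leibniz (D : GeneralizedConnection C) (σ : Sgn) (f : 𝓡) (b a : Γ) (x : M) :
    G.pureCov D σ (f • b) a x =
      f x • G.pureCov D σ b a x + dirDeriv f x (C.anchor x (a x)) • G.component σ b x := by
  have h : G.fibreProj σ x (G.component σ b x) = G.component σ b x :=
    G.fibreProj_of_mem (G.component_mem σ b x)
  rw [G.anchor_component σ, dirDeriv_add_vector]
  simp only [pureCov_apply, map_smul, C.bracket_smul, D.leibniz, map_add, h]
  rw [← G.component_apply σ a]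
  module

theorem pureCov_compatible (D : GeneralizedConnection C) (σ : Sgn) (b c a : Γ) (x : M) :
    dirDeriv (C.inner (G.component σ b) (G.component σ c)) x (C.anchor x (a x)) =
      C.pairing x (G.pureCov D σ b a x) (c x) + C.pairing x (b x) (G.pureCov D σ c a x) := by
  have h : dirDeriv (C.inner (G.component σ b) (G.component σ c)) x
    (C.anchor x (G.component σ.opp a x)) = _ := C.invariant _ _ _ _
  rw [G.anchor_component σ, dirDeriv_add_vector, h, D.compatible]
  simp only [pureCov_apply]
  rw [← G.pairing_fibreProj_right, G.pairing_fibreProj_right σ x (b x)]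
  simp only [← component_apply, map_add, LinearMap.add_apply]
  ring

/-- The metric connection `D'` with `D'_{a_∓} b_± = [a_∓, b_±]_±` and
`D'_{a_±} b_± = (D_{a_±} b_±)_±`. -/
def pureConnection (D : GeneralizedConnection C) : MetricConnection G where
  toGeneralizedConnection := .ofTensorial (fun b => G.pureCov D .pos b + G.pureCov D .neg b)
    (fun b c => by
      ext a x
      simp only [LinearMap.add_apply, ContMDiffSection.coe_add, Pi.add_apply, pureCov_apply,
        map_add]
      abel)
    (fun f b a x => by
      simp only [LinearMap.add_apply, ContMDiffSection.coe_add, Pi.add_apply, pureCov_leibniz]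
      have h := congrArg (fun s : Γ => s x) (G.component_add_opp .pos b)
      conv_rhs => rw [← h]
      simp only [ContMDiffSection.coe_add, Pi.add_apply, Sgn.opp]
      module)
    (fun b c a x => by
      have h : C.inner b c = C.inner (G.component .pos b) (G.component .pos c) +
          C.inner (G.component .neg b) (G.component .neg c) := by
        ext y
        exact G.pairing_eq_add y (b y) (c y)
      rw [h, dirDeriv_add, G.pureCov_compatible D, G.pureCov_compatible D]
      simp only [LinearMap.add_apply, ContMDiffSection.coe_add, Pi.add_apply, map_add]
      ring)
  metric σ a b hb := by
    rw [GeneralizedConnection.ofTensorial_cov, LinearMap.add_apply]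
    cases σ with
    | pos => rw [G.pureCov_eq_zero D .neg hb, add_zero]; exact G.pureCov_mem D .pos b a
    | neg => rw [G.pureCov_eq_zero D .pos hb, zero_add]; exact G.pureCov_mem D .neg b a

theorem pureConnection_cov (D : GeneralizedConnection C) (σ : Sgn) {a b : Γ}
    (ha : a ∈ G.sections σ.opp) (hb : b ∈ G.sections σ) :
    (G.pureConnection D).cov a b = G.component σ (C.bracket a b) := by
  have h : G.pureCov D σ b a = G.component σ (C.bracket a b) := by
    change G.component σ (C.bracket (G.component σ.opp a) (G.component σ b) +
      D.cov (G.component σ a) (G.component σ b)) = _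
    have h0 : D.cov 0 b = 0 := by
      ext x
      exact map_zero (D.toFun b x)
    rw [G.component_of_mem ha, G.component_of_mem hb, G.component_of_mem_opp ha, h0, add_zero]
  have h1 : (G.pureConnection D).cov a b = (G.pureCov D .pos b + G.pureCov D .neg b) a := by
    ext x
    exact fibreMap_apply (G.pureCov D .pos b + G.pureCov D .neg b) a x
  rw [← h, h1, LinearMap.add_apply]
  cases σ with
  | pos => rw [G.pureCov_eq_zero D .neg hb, add_zero]
  | neg => rw [G.pureCov_eq_zero D .pos hb, zero_add]

end GeneralizedMetric

/-! ### Torsion and divergence of a connection -/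

namespace GeneralizedConnection

variable {C : CourantAlgebroid B F E} (D : GeneralizedConnection C)

theorem torsion_eq (a b c : Γ) (x : M) : D.torsion a b c x =
    C.pairing x (D.toFun b x (a x)) (c x) - C.pairing x (D.toFun a x (b x)) (c x) -
      C.pairing x (C.bracket a b x) (c x) + C.pairing x (b x) (D.toFun a x (c x)) := by
  simp only [torsion, ContMDiffSection.coe_sub, Pi.sub_apply, map_sub, LinearMap.sub_apply,
    cov_apply]

/-- `D_b a` as a `C^∞(M)`-linear map in `b`. -/
def covLinear (a : Γ) : Γ →ₗ[𝓡] Γ where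
  toFun b := D.cov b a
  map_add' b c := by
    ext x
    exact map_add (D.toFun a x) (b x) (c x)
  map_smul' f b := by
    ext x
    exact map_smul (D.toFun a x) (f x) (b x)

theorem fibreMap_covLinear (a : Γ) (x : M) : fibreMap (D.covLinear a) x = D.toFun a x := by
  ext v
  obtain ⟨b, rfl⟩ := exists_section_apply_eq (B := B) (F := F) v
  rw [fibreMap_apply]
  rfl

theorem contMDiff_divergence (a : Γ) : ContMDiff 𝓘(ℝ, B) 𝓘(ℝ, ℝ) ∞ (D.divergence a) := by
  have h : D.divergence a = fun x => LinearMap.trace ℝ (E x) (fibreMap (D.covLinear a) x) := by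
    ext x
    rw [fibreMap_covLinear]
    rfl
  rw [h]
  exact C.contMDiff_trace_fibreMap _

/-- The inhomogeneous term of D (f a) is the rank-one map ρ^* df ⊗ a, whose trace is the derivative
of f along ρ a. -/
theorem divergence_smul (f : 𝓡) (a : Γ) (x : M) :
    D.divergence (f • a) x = f x * D.divergence a x + dirDeriv f x (C.anchor x (a x)) := by
  have : FiniteDimensional ℝ (E x) := VectorBundle.finiteDimensional ℝ F E x
  have h : D.toFun (f • a) x =
      f x • D.toFun a x + (dirDerivLinear f x ∘ₗ C.anchor x).smulRight (a x) := by
    ext v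
    exact D.leibniz f a x v
  rw [divergence, h, map_add, map_smul, LinearMap.trace_smulRight]
  rfl

/-- The difference of the divergence of a connection and a divergence operator. -/
def divergenceDefect (div : DivergenceOperator C) : Γ →ₗ[𝓡] 𝓡 where
  toFun a := ⟨D.divergence a, D.contMDiff_divergence a⟩ - div.toFun a
  map_add' a b := by
    ext x
    change D.divergence (a + b) x - div.toFun (a + b) x =
      (D.divergence a x - div.toFun a x) + (D.divergence b x - div.toFun b x)
    have h : D.divergence (a + b) x = D.divergence a x + D.divergence b x := by
      simp [divergence]
    have h' : div.toFun (a + b) x = div.toFun a x + div.toFun b x := by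
      rw [map_add]; rfl
    rw [h, h']
    ring
  map_smul' f a := by
    ext x
    change D.divergence (f • a) x - div.toFun (f • a) x =
      f x * (D.divergence a x - div.toFun a x)
    rw [divergence_smul, div.leibniz]
    ring

end GeneralizedConnection

/-! ### Pure-type torsion through mixed derivatives -/

namespace MetricConnection

variable {C : CourantAlgebroid B F E} {G : GeneralizedMetric C} (D : MetricConnection G)

theorem toFun_mem {σ : Sgn} {b : Γ} (hb : b ∈ G.sections σ) (x : M) (v : E x) :
    D.toFun b x v ∈ G.part σ x := by
  obtain ⟨a, rfl⟩ := exists_section_apply_eq (B := B) (F := F) v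
  exact D.metric σ a b hb x

theorem torsion_add_left (a a' b c : Γ) (x : M) :
    D.torsion (a + a') b c x = D.torsion a b c x + D.torsion a' b c x := by
  simp only [GeneralizedConnection.torsion_eq, map_add, ContMDiffSection.coe_add, Pi.add_apply,
    LinearMap.add_apply]
  ring

theorem torsion_add_middle (a b b' c : Γ) (x : M) :
    D.torsion a (b + b') c x = D.torsion a b c x + D.torsion a b' c x := by
  simp only [GeneralizedConnection.torsion_eq, map_add, ContMDiffSection.coe_add, Pi.add_apply,
    LinearMap.add_apply]
  ring

theorem torsion_add_right (a b c c' : Γ) (x : M) :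
    D.torsion a b (c + c') x = D.torsion a b c x + D.torsion a b c' x := by
  simp only [GeneralizedConnection.torsion_eq, map_add, ContMDiffSection.coe_add, Pi.add_apply]
  ring

/-- For each sign, the one argument of opposite type can sit in any of three slots. In each case
orthogonality removes the unmixed derivatives and the rest cancels against the bracket. -/
theorem hasPureTorsion_of_cov (h : ∀ (σ : Sgn), ∀ a ∈ G.sections σ.opp, ∀ b ∈ G.sections σ,
    D.cov a b = G.component σ (C.bracket a b)) : D.HasPureTorsion := by
  have hD : ∀ (σ : Sgn), ∀ a ∈ G.sections σ.opp, ∀ b ∈ G.sections σ, ∀ x (w : E x),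
      w ∈ G.part σ x →
      C.pairing x (D.toFun b x (a x)) w = C.pairing x (C.bracket a b x) w := by
    intro σ a ha b hb x w hw
    have h1 := congrArg (fun s : Γ => s x) (h σ a ha b hb)
    rw [← G.pairing_fibreProj_of_mem (C.bracket a b x) hw]
    exact congrArg (fun v => C.pairing x v w) h1
  have h1 : ∀ (σ : Sgn), ∀ a ∈ G.sections σ.opp, ∀ b ∈ G.sections σ, ∀ c ∈ G.sections σ, ∀ x,
      D.torsion a b c x = 0 := by
    intro σ a ha b hb c hc x
    rw [GeneralizedConnection.torsion_eq, hD σ a ha b hb x _ (hc x),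
      G.pairing_opp_eq_zero (D.toFun_mem ha x _) (hc x),
      G.pairing_eq_zero σ (hb x) (D.toFun_mem ha x _)]
    ring
  have h2 : ∀ (σ : Sgn), ∀ a ∈ G.sections σ, ∀ b ∈ G.sections σ.opp, ∀ c ∈ G.sections σ, ∀ x,
      D.torsion a b c x = 0 := by
    intro σ a ha b hb c hc x
    rw [GeneralizedConnection.torsion_eq, hD σ b hb a ha x _ (hc x),
      G.pairing_opp_eq_zero (D.toFun_mem hb x _) (hc x),
      G.pairing_opp_eq_zero (hb x) (D.toFun_mem ha x _),
      C.bracket_swap fun y => G.pairing_eq_zero σ (ha y) (hb y)]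
    simp
  have h3 : ∀ (σ : Sgn), ∀ a ∈ G.sections σ, ∀ b ∈ G.sections σ, ∀ c ∈ G.sections σ.opp, ∀ x,
      D.torsion a b c x = 0 := by
    intro σ a ha b hb c hc x
    -- With the odd argument last, what remains is -⟨[a, b], c⟩ + ⟨b, [c, a]⟩, and this is minus the
    -- derivative of the vanishing function ⟨b, c⟩ along ρ a.
    have h0 : C.inner b c = 0 := by
      ext y
      exact G.pairing_eq_zero σ (hb y) (hc y)
    have hinv : dirDeriv (C.inner b c) x (C.anchor x (a x)) = _ := C.invariant a b c x
    have hz : dirDeriv (0 : 𝓡) x (C.anchor x (a x)) = 0 := dirDeriv_const 0 x _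
    rw [h0, hz] at hinv
    rw [GeneralizedConnection.torsion_eq, G.pairing_eq_zero σ (D.toFun_mem hb x _) (hc x),
      G.pairing_eq_zero σ (D.toFun_mem ha x _) (hc x), C.pairing_symm x (b x),
      hD σ c hc a ha x _ (hb x),
      C.bracket_swap fun y => G.pairing_opp_eq_zero (hc y) (ha y), C.pairing_symm x _ (b x)]
    simp only [ContMDiffSection.coe_neg, Pi.neg_apply, map_neg]
    linarith
  intro a b c x
  have m := fun (σ : Sgn) (s : Γ) => G.component_mem σ s
  -- Of the eight components of the torsion, the six mixed ones vanish.
  conv_lhs => rw [← G.component_add_opp .pos a, ← G.component_add_opp .pos b,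
    ← G.component_add_opp .pos c]
  simp only [torsion_add_left, torsion_add_middle, torsion_add_right, Sgn.opp]
  rw [h1 .pos _ (m .neg a) _ (m .pos b) _ (m .pos c), h2 .pos _ (m .pos a) _ (m .neg b) _ (m .pos c),
    h3 .pos _ (m .pos a) _ (m .pos b) _ (m .neg c), h1 .neg _ (m .pos a) _ (m .neg b) _ (m .neg c),
    h2 .neg _ (m .neg a) _ (m .pos b) _ (m .neg c), h3 .neg _ (m .neg a) _ (m .neg b) _ (m .pos c)]
  simp only [zero_add, add_zero]
  rfl

/-- The mixed torsion T(a_∓, b_±, c_±) is zero, and its terms containing D a_∓ vanish because D a_∓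
stays in V_∓. Nondegeneracy then identifies D_{a_∓} b_±. -/
theorem cov_eq_of_hasPureTorsion (h : D.HasPureTorsion) (σ : Sgn) {a b : Γ}
    (ha : a ∈ G.sections σ.opp) (hb : b ∈ G.sections σ) :
    D.cov a b = G.component σ (C.bracket a b) := by
  have key : ∀ c ∈ G.sections σ, ∀ x, D.torsion a b c x = 0 := by
    intro c hc x
    rw [h a b c x]
    change D.torsion (G.component .pos a) (G.component .pos b) (G.component .pos c) x +
      D.torsion (G.component .neg a) (G.component .neg b) (G.component .neg c) x = 0
    cases σ with
    | pos =>
      have hc' : G.component .neg c = 0 := G.component_opp_of_mem (σ := .pos) hc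
      rw [G.component_of_mem_opp (σ := .pos) ha, hc']
      simp [GeneralizedConnection.torsion_eq]
    | neg =>
      have hc' : G.component .pos c = 0 := G.component_opp_of_mem (σ := .neg) hc
      rw [G.component_of_mem_opp (σ := .neg) ha, hc']
      simp [GeneralizedConnection.torsion_eq]
  ext x
  refine CourantAlgebroid.pairing_ext (C := C) fun z => ?_
  obtain ⟨c, rfl⟩ := exists_section_apply_eq (B := B) (F := F) z
  have h1 := key (G.component σ c) (G.component_mem σ c) x
  rw [GeneralizedConnection.torsion_eq,
    G.pairing_opp_eq_zero (D.toFun_mem ha x _) (G.component_mem σ c x),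
    G.pairing_eq_zero σ (hb x) (D.toFun_mem ha x _), sub_zero, add_zero] at h1
  rw [D.cov_apply, ← G.fibreProj_of_mem (D.toFun_mem hb x (a x)), ← G.pairing_fibreProj_right,
    G.component_apply, ← G.pairing_fibreProj_right]
  exact sub_eq_zero.1 h1

end MetricConnection

/-! ### Vectorial terms and traces on V_± -/

namespace GeneralizedMetric

variable {C : CourantAlgebroid B F E} (G : GeneralizedMetric C)

/-- The endomorphism `v ↦ ⟨b_±, v_±⟩ χ_± - ⟨χ_±, b_±⟩ v_±` of the fibre at `x`. -/
def vectorialTerm (σ : Sgn) (x : M) (χ b : E x) : E x →ₗ[ℝ] E x :=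
  (C.pairing x (G.fibreProj σ x b)).smulRight (G.fibreProj σ x χ) -
    C.pairing x (G.fibreProj σ x χ) b • G.fibreProj σ x

theorem vectorialTerm_apply (σ : Sgn) (x : M) (χ b v : E x) : G.vectorialTerm σ x χ b v =
    C.pairing x (G.fibreProj σ x b) v • G.fibreProj σ x χ -
      C.pairing x (G.fibreProj σ x χ) b • G.fibreProj σ x v := rfl

theorem vectorialTerm_mem (σ : Sgn) (x : M) (χ b v : E x) :
    G.vectorialTerm σ x χ b v ∈ G.part σ x :=
  Submodule.sub_mem _ (Submodule.smul_mem _ _ (G.fibreProj_mem _ _ _))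
    (Submodule.smul_mem _ _ (G.fibreProj_mem _ _ _))

theorem vectorialTerm_add (σ : Sgn) (x : M) (χ b c : E x) :
    G.vectorialTerm σ x χ (b + c) = G.vectorialTerm σ x χ b + G.vectorialTerm σ x χ c := by
  ext v
  simp only [vectorialTerm_apply, LinearMap.add_apply, map_add]
  module

theorem vectorialTerm_smul (σ : Sgn) (x : M) (χ : E x) (r : ℝ) (b : E x) :
    G.vectorialTerm σ x χ (r • b) = r • G.vectorialTerm σ x χ b := by
  ext v
  simp only [vectorialTerm_apply, LinearMap.smul_apply, map_smul, smul_eq_mul]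
  module

theorem vectorialTerm_of_mem_opp {σ : Sgn} {x : M} (χ : E x) {b : E x}
    (hb : b ∈ G.part σ.opp x) : G.vectorialTerm σ x χ b = 0 := by
  ext v
  rw [vectorialTerm_apply, G.fibreProj_of_mem_opp hb,
    G.pairing_eq_zero σ (G.fibreProj_mem σ x χ) hb]
  simp

theorem vectorialTerm_apply_of_mem_opp {σ : Sgn} {x : M} (χ b : E x) {v : E x}
    (hv : v ∈ G.part σ.opp x) : G.vectorialTerm σ x χ b v = 0 := by
  rw [vectorialTerm_apply, G.fibreProj_of_mem_opp hv,
    G.pairing_eq_zero σ (G.fibreProj_mem σ x b) hv]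
  simp

/-- Skew-symmetry in b and c is what keeps a connection compatible with the pairing after the term
is added. -/
theorem vectorialTerm_skew (σ : Sgn) (x : M) (χ b c v : E x) :
    C.pairing x (G.vectorialTerm σ x χ b v) c + C.pairing x b (G.vectorialTerm σ x χ c v) = 0 := by
  simp only [vectorialTerm_apply, map_sub, map_smul, LinearMap.sub_apply, LinearMap.smul_apply,
    smul_eq_mul]
  rw [C.pairing_symm x b, G.pairing_fibreProj_right σ x b, ← G.pairing_fibreProj_right σ x v,
    C.pairing_symm x v]
  ring

/-- The rank-one part contributes 1 and the multiple of the projection contributes minus the rank.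
The factor vanishes exactly in rank 1. -/
theorem trace_vectorialTerm (σ : Sgn) (x : M) (χ b : E x) :
    LinearMap.trace ℝ (E x) (G.vectorialTerm σ x χ b) =
      (1 - (Module.finrank ℝ (G.part σ x) : ℝ)) * C.pairing x χ (G.fibreProj σ x b) := by
  have : FiniteDimensional ℝ (E x) := VectorBundle.finiteDimensional ℝ F E x
  rw [vectorialTerm, map_sub, map_smul, LinearMap.trace_smulRight, trace_fibreProj,
    C.pairing_symm x (G.fibreProj σ x b), ← G.pairing_fibreProj_right,
    G.fibreProj_of_mem (G.fibreProj_mem _ _ _), G.pairing_fibreProj_right σ x χ b, smul_eq_mul]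
  ring

theorem contMDiff_vectorialTerm (σ : Sgn) (χ b a : Γ) :
    ContMDiff 𝓘(ℝ, B) (𝓘(ℝ, B).prod 𝓘(ℝ, F)) ∞
      fun x => TotalSpace.mk' F x (G.vectorialTerm σ x (χ x) (b x) (a x)) :=
  (C.inner (G.component σ b) a • G.component σ χ -
    C.inner (G.component σ χ) b • G.component σ a).contMDiff

/-- Extending an endomorphism of V_± by zero on V_∓ does not change its trace, by cyclicity. All
traces can thus be compared on E. -/
theorem tr_eq_trace (σ : Sgn) (Φ : G.sections σ →ₗ[𝓡] G.sections σ) (x : M) : G.tr σ Φ x =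
    LinearMap.trace ℝ (E x) (fibreMap ((G.sections σ).subtype ∘ₗ Φ ∘ₗ G.proj σ) x) := by
  have : FiniteDimensional ℝ (E x) := VectorBundle.finiteDimensional ℝ F E x
  rw [tr, fibreEnd, LinearMap.comp_assoc, LinearMap.trace_comp_comm', LinearMap.comp_assoc]
  congr 1
  ext v
  obtain ⟨s, rfl⟩ := exists_section_apply_eq (B := B) (F := F) v
  change fibreMap _ x (G.component σ s x) = _
  rw [fibreMap_apply, fibreMap_apply]
  change (Φ (G.proj σ (G.component σ s))).1 x = (Φ (G.proj σ s)).1 x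
  have h : G.proj σ (G.component σ s) = G.proj σ s :=
    Subtype.ext (G.component_of_mem (G.component_mem σ s))
  rw [h]

theorem trace_comp_fibreProj {σ : Sgn} {x : M} {L : E x →ₗ[ℝ] E x}
    (hL : ∀ v, L v ∈ G.part σ x) :
    LinearMap.trace ℝ (E x) (L ∘ₗ G.fibreProj σ x) = LinearMap.trace ℝ (E x) L := by
  have : FiniteDimensional ℝ (E x) := VectorBundle.finiteDimensional ℝ F E x
  rw [LinearMap.trace_comp_comm']
  congr 1
  ext v
  exact G.fibreProj_of_mem (hL v)

end GeneralizedMetric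

/-! ### Correction of the divergence and comparison of the Ricci tensors -/

namespace MetricConnection

variable {C : CourantAlgebroid B F E} {G : GeneralizedMetric C} (D : MetricConnection G)

/-- The modification of a metric connection by the vectorial terms of a section `χ`, weighted by
functions `g`. -/
def addVectorial (χ : Γ) (g : Sgn → 𝓡) : MetricConnection G where
  toFun :=
    { toFun := fun b x => D.toFun b x + (g .pos x • G.vectorialTerm .pos x (χ x) (b x) +
        g .neg x • G.vectorialTerm .neg x (χ x) (b x))
      map_add' := fun b c => by
        ext1 x
        simp only [map_add, Pi.add_apply, ContMDiffSection.coe_add, G.vectorialTerm_add]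
        module
      map_smul' := fun r b => by
        ext1 x
        simp only [map_smul, Pi.smul_apply, ContMDiffSection.coe_smul, G.vectorialTerm_smul,
          RingHom.id_apply]
        module }
  smooth b a :=
    (D.smooth b a).add_section
      (((g .pos).contMDiff.smul_section (G.contMDiff_vectorialTerm .pos χ b a)).add_section
        ((g .neg).contMDiff.smul_section (G.contMDiff_vectorialTerm .neg χ b a)))
  leibniz f b x v := by
    simp only [LinearMap.coe_mk, AddHom.coe_mk, LinearMap.add_apply, LinearMap.smul_apply,
      D.leibniz, smul_section_apply, G.vectorialTerm_smul]
    module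
  compatible b c x v := by
    have h1 := G.vectorialTerm_skew .pos x (χ x) (b x) (c x) v
    have h2 := G.vectorialTerm_skew .neg x (χ x) (b x) (c x) v
    simp only [LinearMap.coe_mk, AddHom.coe_mk, LinearMap.add_apply, LinearMap.smul_apply,
      D.compatible, map_add, map_smul, smul_eq_mul]
    linear_combination -(g .pos x) * h1 - g .neg x * h2
  metric σ a b hb x := by
    change D.toFun b x (a x) + (g .pos x • G.vectorialTerm .pos x (χ x) (b x) (a x) +
        g .neg x • G.vectorialTerm .neg x (χ x) (b x) (a x)) ∈ G.part σ x
    refine Submodule.add_mem _ (D.toFun_mem hb x _) ?_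
    cases σ with
    | pos =>
      rw [G.vectorialTerm_of_mem_opp (σ := .neg) (χ x) (hb x), LinearMap.zero_apply, smul_zero,
        add_zero]
      exact Submodule.smul_mem _ _ (G.vectorialTerm_mem _ _ _ _ _)
    | neg =>
      rw [G.vectorialTerm_of_mem_opp (σ := .pos) (χ x) (hb x), LinearMap.zero_apply, smul_zero,
        zero_add]
      exact Submodule.smul_mem _ _ (G.vectorialTerm_mem _ _ _ _ _)

theorem addVectorial_toFun (χ : Γ) (g : Sgn → 𝓡) (b : Γ) (x : M) :
    (D.addVectorial χ g).toFun b x = D.toFun b x +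
      (g .pos x • G.vectorialTerm .pos x (χ x) (b x) +
        g .neg x • G.vectorialTerm .neg x (χ x) (b x)) := rfl

/-- A vectorial term only sees components of b and v of the same sign, so the mixed derivatives,
which alone decide purity, are unchanged. -/
theorem addVectorial_hasPureTorsion (h : D.HasPureTorsion) (χ : Γ) (g : Sgn → 𝓡) :
    (D.addVectorial χ g).HasPureTorsion := by
  refine hasPureTorsion_of_cov _ fun σ a ha b hb => ?_
  rw [← D.cov_eq_of_hasPureTorsion h σ ha hb]
  ext x
  rw [GeneralizedConnection.cov_apply, addVectorial_toFun]
  simp only [LinearMap.add_apply, LinearMap.smul_apply]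
  cases σ with
  | pos =>
    rw [G.vectorialTerm_of_mem_opp (σ := .neg) (χ x) (hb x),
      G.vectorialTerm_apply_of_mem_opp (σ := .pos) (χ x) (b x) (ha x)]
    simp [GeneralizedConnection.cov_apply]
  | neg =>
    rw [G.vectorialTerm_of_mem_opp (σ := .pos) (χ x) (hb x),
      G.vectorialTerm_apply_of_mem_opp (σ := .neg) (χ x) (b x) (ha x)]
    simp [GeneralizedConnection.cov_apply]

theorem exists_hasDivergence_hasPureTorsion [SecondCountableTopology M] (G : GeneralizedMetric C)
    (div : DivergenceOperator C)
    (hrk : ∀ (σ : Sgn) (x : M), Module.finrank ℝ (G.part σ x) ≠ 1) :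
    ∃ D : MetricConnection G, D.HasDivergence div ∧ D.HasPureTorsion := by
  obtain ⟨D₀⟩ := GeneralizedConnection.nonempty C
  let D := G.pureConnection D₀
  have hD : D.HasPureTorsion := D.hasPureTorsion_of_cov fun σ a ha b hb =>
    G.pureConnection_cov D₀ σ ha hb
  have hne : ∀ σ x, (Module.finrank ℝ (G.part σ x) : ℝ) - 1 ≠ 0 := fun σ x =>
    sub_ne_zero.2 fun h => hrk σ x (by exact_mod_cast h)
  -- With these weights each term has trace -⟨χ, b_±⟩, so the two together subtract ⟨χ, b⟩, the
  -- excess of the divergence of `D`. Rank 0 is harmless: there b_± = 0.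
  let g : Sgn → 𝓡 := fun σ => ⟨fun x => ((Module.finrank ℝ (G.part σ x) : ℝ) - 1)⁻¹,
    ((G.contMDiff_finrank σ).sub contMDiff_const).inv₀ (hne σ)⟩
  have hg : ∀ σ x, g σ x * (1 - (Module.finrank ℝ (G.part σ x) : ℝ)) = -1 := fun σ x => by
    change ((Module.finrank ℝ (G.part σ x) : ℝ) - 1)⁻¹ * _ = _
    field_simp [hne σ x]
    ring
  let χ := C.riesz (D.divergenceDefect div)
  refine ⟨D.addVectorial χ g, fun b x => ?_, D.addVectorial_hasPureTorsion hD χ g⟩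
  have hχ : C.pairing x (χ x) (b x) = D.divergence b x - div.toFun b x := C.pairing_riesz _ b x
  rw [← G.fibreProj_pos_add_neg x (b x), map_add] at hχ
  rw [GeneralizedConnection.divergence, addVectorial_toFun]
  simp only [map_add, map_smul, G.trace_vectorialTerm, smul_eq_mul]
  rw [GeneralizedConnection.divergence] at hχ
  linear_combination C.pairing x (χ x) (G.fibreProj .pos x (b x)) * hg .pos x +
    C.pairing x (χ x) (G.fibreProj .neg x (b x)) * hg .neg x - hχ

/-- The covariant derivative along `a` of the endomorphism `c ↦ D_c b`. -/
def covDerivCov (a b : Γ) : Γ →ₗ[𝓡] Γ where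
  toFun c := D.cov a (D.cov c b) - D.cov (D.cov a c) b
  map_add' c d := by
    have h : D.cov (c + d) b = D.cov c b + D.cov d b := map_add (D.covLinear b) c d
    have h' : D.cov a (c + d) = D.cov a c + D.cov a d := by
      ext x
      simp [GeneralizedConnection.cov_apply]
    ext x
    rw [h, h']
    simp only [ContMDiffSection.coe_sub, ContMDiffSection.coe_add, Pi.sub_apply, Pi.add_apply,
      GeneralizedConnection.cov_apply, map_add, LinearMap.add_apply]
    abel
  map_smul' f c := by
    have h : D.cov (f • c) b = f • D.cov c b := map_smul (D.covLinear b) f c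
    ext x
    rw [h]
    simp only [ContMDiffSection.coe_sub, Pi.sub_apply, smul_section_apply,
      GeneralizedConnection.cov_apply, D.leibniz, map_add, map_smul, RingHom.id_apply]
    module

theorem ricciGF_eq_ricciSV {div : DivergenceOperator C} (hdiv : D.HasDivergence div)
    (hT : D.HasPureTorsion) (σ : Sgn) (a : G.sections σ.opp) (b : G.sections σ) (x : M) :
    D.ricciGF σ a b x = G.ricciSV div σ a b x := by
  obtain ⟨a, ha⟩ := a
  obtain ⟨b, hb⟩ := b
  have hab := D.cov_eq_of_hasPureTorsion hT σ ha hb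
  -- The heart of the comparison: the curvature endomorphism equals D(D_a b) minus D_a(D b) minus
  -- the double bracket, before any trace is taken.
  have hfib : fibreMap ((G.sections σ).subtype ∘ₗ D.curvatureGF σ ⟨a, ha⟩ ⟨b, hb⟩ ∘ₗ G.proj σ) x =
      D.toFun (G.component σ (C.bracket a b)) x ∘ₗ G.fibreProj σ x -
        fibreMap (D.covDerivCov a b) x ∘ₗ G.fibreProj σ x -
        fibreMap ((G.sections σ).subtype ∘ₗ G.doubleBracket σ ⟨a, ha⟩ ⟨b, hb⟩ ∘ₗ G.proj σ) x := by
    ext v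
    obtain ⟨s, rfl⟩ := exists_section_apply_eq (B := B) (F := F) v
    let c := G.component σ s
    have hc : c ∈ G.sections σ := G.component_mem σ s
    simp only [LinearMap.sub_apply, LinearMap.comp_apply, ← G.component_apply, fibreMap_apply]
    change D.naiveCurvature c a b x = D.toFun (G.component σ (C.bracket a b)) x (c x) -
      (D.cov a (D.cov c b) - D.cov (D.cov a c) b) x -
      G.component σ (C.bracket (G.component σ.opp (C.bracket c a)) b) x
    -- This sign turns the V_± part of the term -D_{[c, a]} b into D_{D_a c} b, which completes -D_a
    -- D_c b to minus the covariant derivative of c ↦ D_c b.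
    have h1 : D.cov a c = - G.component σ (C.bracket c a) := by
      rw [D.cov_eq_of_hasPureTorsion hT σ ha hc,
        C.bracket_swap fun y => G.pairing_opp_eq_zero (ha y) (hc y), map_neg]
    have h2 := D.cov_eq_of_hasPureTorsion hT σ (G.component_mem σ.opp (C.bracket c a)) hb
    have h3 : D.cov (C.bracket c a) b = D.cov (G.component σ (C.bracket c a)) b +
        D.cov (G.component σ.opp (C.bracket c a)) b := by
      conv_lhs => rw [← G.component_add_opp σ (C.bracket c a)]
      exact map_add (D.covLinear b) _ _
    have h4 : D.cov (-G.component σ (C.bracket c a)) b = -D.cov (G.component σ (C.bracket c a)) b :=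
      map_neg (D.covLinear b) _
    rw [← h2, ← hab, GeneralizedConnection.naiveCurvature, h1, h3, h4, ← D.cov_apply c]
    simp only [ContMDiffSection.coe_sub, ContMDiffSection.coe_add, ContMDiffSection.coe_neg,
      Pi.sub_apply, Pi.add_apply, Pi.neg_apply]
    abel
  have htr : LinearMap.trace ℝ (E x) (fibreMap (D.covDerivCov a b) x) =
      dirDeriv (div.toFun b) x (C.anchor x (a x)) :=
    D.trace_covariant_derivative a (D.covLinear b) _ (fun c => rfl) (div.toFun b) (fun y => by
      rw [D.fibreMap_covLinear]
      exact (hdiv b y).symm) x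
  have hcov : ∀ v, fibreMap (D.covDerivCov a b) x v ∈ G.part σ x := fun v => by
    obtain ⟨c, rfl⟩ := exists_section_apply_eq (B := B) (F := F) v
    rw [fibreMap_apply]
    exact (G.part σ x).sub_mem (D.metric σ _ _ (D.metric σ _ _ hb) x) (D.metric σ _ _ hb x)
  rw [ricciGF, GeneralizedMetric.ricciSV, G.tr_eq_trace, G.tr_eq_trace, hfib, map_sub, map_sub,
    G.trace_comp_fibreProj hcov, htr,
    G.trace_comp_fibreProj fun v => D.toFun_mem (G.component_mem σ _) x v]
  congr 2
  exact hdiv _ x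

end MetricConnection

end Connections

end CourantRicci

end

theorem mainTheorem2
    {B : Type*} [NormedAddCommGroup B] [NormedSpace ℝ B] [FiniteDimensional ℝ B]
    {M : Type*} [TopologicalSpace M] [T2Space M] [SecondCountableTopology M]
    [ChartedSpace B M] [IsManifold 𝓘(ℝ, B) ∞ M]
    {F : Type*} [NormedAddCommGroup F] [NormedSpace ℝ F] [FiniteDimensional ℝ F]
    {E : M → Type*} [∀ x, AddCommGroup (E x)] [∀ x, Module ℝ (E x)]
    [∀ x, TopologicalSpace (E x)] [TopologicalSpace (TotalSpace F E)]
    [FiberBundle F E] [VectorBundle ℝ F E] [ContMDiffVectorBundle ∞ F E 𝓘(ℝ, B)]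
    (C : CourantRicci.CourantAlgebroid B F E) (G : CourantRicci.GeneralizedMetric C)
    (div : CourantRicci.DivergenceOperator C)
    (hrk : ∀ (σ : CourantRicci.Sgn) (x : M), Module.finrank ℝ (G.part σ x) ≠ 1) :
    (∃ D : CourantRicci.MetricConnection G, D.HasDivergence div ∧ D.HasPureTorsion) ∧
    ∀ D : CourantRicci.MetricConnection G, D.HasDivergence div → D.HasPureTorsion →
      ∀ (σ : CourantRicci.Sgn) (a : G.sections σ.opp) (b : G.sections σ) (x : M),
        D.ricciGF σ a b x = G.ricciSV div σ a b x :=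
  ⟨CourantRicci.MetricConnection.exists_hasDivergence_hasPureTorsion G div hrk,
    fun D hdiv hT σ a b x => D.ricciGF_eq_ricciSV hdiv hT σ a b x⟩
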